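/- There exists a Boolean algebra $\mathcal B$ that is $\sigma$-complete (every countable subset has a least upper bound), satisfies the countable chain condition and the weak $(\sigma,\infty)$-distributive law, but is not a measure algebra. Here a subset $\mathcal C\subset\mathcal B$ is called disjoint if $A\cap B=0$ for all distinct $A,B\in\mathcal C$, and a partition if moreover its least upper bound is $1$. The countable chain condition says that every disjoint subset of $\mathcal B$ is countable. The weak $(\sigma,\infty)$-distributive law says that for every sequence $(\Pi_n)$ of partitions of $\mathcal B$ there is a single partition $\Pi$ of $\mathcal B$ such that for every $A\in\Pi$ and every $n$ there is a finite subset $\{A_1,\dots,A_k\}$ of $\Pi_n$ with $A\subset A_1\cup\dots\cup A_k$. A measure algebra is a $\sigma$-complete Boolean algebra $\mathcal B$ on which there is a map $\mu:\mathcal B\to[0,\infty)$ such that $\mu(0)=0$; $\mu(A\cup B)=\mu(A)+\mu(B)$ whenever $A\cap B=0$; $\mu(A_n)\to0$ for every decreasing sequence $(A_n)$ with greatest lower bound $0$; and $\mu(A)=0$ only if $A=0$. -/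

import Mathlib

open Filter Topology
open scoped NNReal

namespace VonNeumann

/-- Every countable subset has a least upper bound. -/
def IsSigmaComplete (B : Type*) [BooleanAlgebra B] : Prop :=
  ∀ C : Set B, C.Countable → ∃ a : B, IsLUB C a

/-- A subset is disjoint if any two distinct members have meet `⊥`. -/
def IsDisjointSet {B : Type*} [BooleanAlgebra B] (C : Set B) : Prop :=
  ∀ a ∈ C, ∀ b ∈ C, a ≠ b → a ⊓ b = ⊥

/-- The countable chain condition: every disjoint subset is countable. -/
def CountableChainCondition (B : Type*) [BooleanAlgebra B] : Prop :=
  ∀ C : Set B, IsDisjointSet C → C.Countable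

/-- A partition is a disjoint subset with least upper bound `⊤`. -/
def IsPartition {B : Type*} [BooleanAlgebra B] (P : Set B) : Prop :=
  IsDisjointSet P ∧ IsLUB P ⊤

/-- `a` lies below the join of finitely many members of `P`. -/
def FinitelyCovered {B : Type*} [BooleanAlgebra B] (a : B) (P : Set B) : Prop :=
  ∃ F : Finset B, (F : Set B) ⊆ P ∧ a ≤ F.sup id

/-- The weak (σ,∞)-distributive law (also called the general distributive law). -/
def WeakSigmaInftyDistributive (B : Type*) [BooleanAlgebra B] : Prop :=
  ∀ P : ℕ → Set B, (∀ n, IsPartition (P n)) →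
    ∃ Q : Set B, IsPartition Q ∧ ∀ a ∈ Q, ∀ n, FinitelyCovered a (P n)

/-- A submeasure: a finite nonnegative, monotone, subadditive function vanishing at `⊥`. -/
structure IsSubmeasure {B : Type*} [BooleanAlgebra B] (ν : B → ℝ≥0) : Prop where
  map_bot : ν ⊥ = 0
  mono : ∀ a b : B, a ≤ b → ν a ≤ ν b
  sup_le : ∀ a b : B, ν (a ⊔ b) ≤ ν a + ν b

/-- A (finitely additive) measure: a submeasure that is additive on disjoint elements. -/
structure IsFinAddMeasure {B : Type*} [BooleanAlgebra B] (μ : B → ℝ≥0) : Prop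
    extends IsSubmeasure μ where
  sup_eq : ∀ a b : B, a ⊓ b = ⊥ → μ (a ⊔ b) = μ a + μ b

/-- Continuity: the values along every decreasing sequence with infimum `⊥` tend to `0`. -/
def IsContinuous {B : Type*} [BooleanAlgebra B] (ν : B → ℝ≥0) : Prop :=
  ∀ A : ℕ → B, Antitone A → IsGLB (Set.range A) ⊥ → Tendsto (fun n => ν (A n)) atTop (𝓝 0)

/-- Positivity: only `⊥` has value `0`. -/
def IsPositive {B : Type*} [BooleanAlgebra B] (ν : B → ℝ≥0) : Prop :=
  ∀ a : B, ν a = 0 → a = ⊥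

/-- A measure algebra: a σ-complete Boolean algebra with a positive continuous measure. -/
def IsMeasureAlgebra (B : Type*) [BooleanAlgebra B] : Prop :=
  IsSigmaComplete B ∧ ∃ μ : B → ℝ≥0, IsFinAddMeasure μ ∧ IsContinuous μ ∧ IsPositive μ

end VonNeumann

namespace VonNeumann

/-! ### Weights -/

/-! Talagrand's construction gives an exhaustive submeasure on the clopen subsets of `Seq` that is
at least 1 on every set `{z | z n = τ}`. Its outer extension stays exhaustive on the σ-algebra of
approximable sets, and modulo null sets it becomes a positive continuous submeasure on a σ-complete
algebra (`isMaharam_quotientMeasure`). Such a submeasure forces the chain condition and the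
distributive law. It would also be absolutely continuous with respect to any positive continuous
measure (`IsMaharam.exists_forall_lt`); then, for every `n`, the `n + 1` disjoint sets `{z | z n =
τ}` would all have measure above one fixed positive bound, which is absurd.

The submeasure is the least weight of a finite cover by items. An item of level `l` weighs at least
`2 ^ (-l)`, and its set is thin across every gap `[m, n)` between two of its indices: from each atom
at `m`, what its trace leaves free cannot be covered by higher items of total weight below 1.
Exhaustivity (`eventually_small`): given disjoint cylinders `E i`, one can remove a set `H` meeting
all but finitely many `E i` in small sets, so that `E i \ H` is thin across as many gaps as desired
and is itself a cheap item. Nontriviality (`not_small_univ`): in a cheap cover the items of lowest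
level are few and have large index sets, so each receives its own gap, disjoint from the others and
light for the higher items. A point is built block by block, evading each lowest item in its gap and
each higher item in a block holding a good share of its indices.

Thinness refers to higher levels, so levels are cut off at `p` and the limit is taken along an
ultrafilter. Covers can be localized to given coordinates (`exists_localized_cover`), which leaves
finitely many candidates and makes the limit effective. -/

/-- The factor by which the index set of an item of level at least `l` may shrink. -/
def shrink (l : ℕ) : ℕ := 2 ^ (l + 6)

/-- A lower bound for the size of the index sets of relevant items of level `l`. -/
def minCard (l : ℕ) : ℕ := 2 ^ (2 * l + 16)

/-- The relative increase of weight when an index set shrinks by the factor `shrink l`. -/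
noncomputable def slack (l : ℕ) : ℝ := (1 / 2) ^ (l + 2)

lemma slack_pos (l : ℕ) : 0 < slack l := by unfold slack; positivity

lemma slack_anti {k l : ℕ} (h : k ≤ l) : slack l ≤ slack k :=
  pow_le_pow_of_le_one (by norm_num) (by norm_num) (by omega)

lemma slack_le (l : ℕ) : slack l ≤ 1 / 4 := by
  have := slack_anti (Nat.zero_le l)
  norm_num [slack] at this ⊢
  linarith

/-- This exponent makes an index set that has shrunk so many times weigh at least 16: the factor `2
^ l` cancels the base weight. -/
lemma exists_slack_pow (l : ℕ) : ∃ a : ℕ, (16 * 2 ^ l : ℝ) ≤ (1 + slack l) ^ a := by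
  obtain ⟨a, ha⟩ := pow_unbounded_of_one_lt (16 * 2 ^ l : ℝ)
    (by linarith [slack_pos l] : 1 < 1 + slack l)
  exact ⟨a, ha.le⟩

/-- The maximal size of the index set of an item of level `l`. -/
noncomputable def maxCard (l : ℕ) : ℕ := minCard l * shrink l ^ (exists_slack_pow l).choose

/-- The number of times that `maxCard l` must be divided by `shrink l` to get below `j`. -/
noncomputable def depth (l j : ℕ) : ℕ := sInf {e | maxCard l ≤ j * shrink l ^ e}

/-- The weight of an item of level `l` whose index set has `j` elements. -/
noncomputable def wgt (l j : ℕ) : ℝ := (1 / 2) ^ l * (1 + slack l) ^ depth l j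

lemma wgt_pos (l j : ℕ) : 0 < wgt l j := by
  have := slack_pos l
  unfold wgt
  positivity

lemma pow_le_wgt (l j : ℕ) : (1 / 2) ^ l ≤ wgt l j := by
  have : 1 ≤ (1 + slack l) ^ depth l j := one_le_pow₀ (by linarith [slack_pos l])
  unfold wgt
  have h : (0 : ℝ) < (1 / 2) ^ l := by positivity
  nlinarith

lemma wgt_maxCard (l : ℕ) : wgt l (maxCard l) = (1 / 2) ^ l := by
  have : depth l (maxCard l) = 0 := by
    refine Nat.sInf_eq_zero.2 (Or.inl ?_)
    simp
  simp [wgt, this]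

lemma maxCard_pos (l : ℕ) : 0 < maxCard l := by
  unfold maxCard minCard shrink; positivity

lemma depth_spec {l j : ℕ} (hj : 0 < j) : maxCard l ≤ j * shrink l ^ depth l j := by
  refine Nat.sInf_mem (s := {e | maxCard l ≤ j * shrink l ^ e}) ⟨maxCard l, ?_⟩
  have h1 : maxCard l ≤ shrink l ^ maxCard l := by
    refine (Nat.lt_pow_self ?_).le
    unfold shrink
    exact Nat.one_lt_two_pow (by omega)
  exact h1.trans (Nat.le_mul_of_pos_left _ hj)

/-- Weight below 16 means fewer shrinkings than the exponent built into `maxCard`, so a factor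
`minCard l` is left over. -/
lemma minCard_le_of_wgt_lt {l j : ℕ} (hj : 0 < j) (h : wgt l j < 16) : minCard l ≤ j := by
  have hs := depth_spec (l := l) hj
  have ha := (exists_slack_pow l).choose_spec
  have hlt : depth l j < (exists_slack_pow l).choose := by
    by_contra! hc
    have h1 : (1 + slack l) ^ (exists_slack_pow l).choose ≤ (1 + slack l) ^ depth l j :=
      pow_le_pow_right₀ (by linarith [slack_pos l]) hc
    have h2 : (16 : ℝ) = (1 / 2) ^ l * (16 * 2 ^ l) := by
      rw [mul_left_comm, ← mul_pow]; norm_num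
    have h3 : (1 / 2 : ℝ) ^ l * (16 * 2 ^ l) ≤ wgt l j := by
      unfold wgt
      exact mul_le_mul_of_nonneg_left (ha.trans h1) (by positivity)
    linarith
  have h4 : minCard l * shrink l ^ depth l j ≤ j * shrink l ^ depth l j := by
    refine le_trans ?_ hs
    unfold maxCard
    exact Nat.mul_le_mul_left _ (Nat.pow_le_pow_right (by unfold shrink; positivity) hlt.le)
  exact Nat.le_of_mul_le_mul_right h4 (by unfold shrink; positivity)

/-- One shrinking raises the depth by at most one. Both `shrink k ≤ shrink l` and `slack l ≤ slack
k` go the right way, so the constants of `k` serve all levels above it. -/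
lemma wgt_le_of_shrink {k l j j' : ℕ} (hkl : k ≤ l) (hj : 0 < j) (h : j ≤ shrink k * j') :
    wgt l j' ≤ (1 + slack k) * wgt l j := by
  have hs := depth_spec (l := l) hj
  have hd : depth l j' ≤ depth l j + 1 := by
    refine Nat.sInf_le ?_
    have hq : shrink k ≤ shrink l := Nat.pow_le_pow_right (by norm_num) (by omega)
    calc maxCard l ≤ j * shrink l ^ depth l j := hs
      _ ≤ (shrink l * j') * shrink l ^ depth l j :=
          Nat.mul_le_mul_right _ (h.trans (Nat.mul_le_mul_right _ hq))
      _ = j' * shrink l ^ (depth l j + 1) := by ring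
  have h1 : (1 + slack l) ^ depth l j' ≤ (1 + slack l) ^ (depth l j + 1) :=
    pow_le_pow_right₀ (by linarith [slack_pos l]) hd
  have h2 := slack_anti hkl
  have h3 := slack_pos l
  have h4 := wgt_pos l j
  calc wgt l j' ≤ (1 / 2) ^ l * (1 + slack l) ^ (depth l j + 1) :=
        mul_le_mul_of_nonneg_left h1 (by positivity)
    _ = (1 + slack l) * wgt l j := by unfold wgt; ring
    _ ≤ (1 + slack k) * wgt l j := mul_le_mul_of_nonneg_right (by linarith) h4.le

/-- The bound below which items of level at least `k` cannot cover the whole space. -/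
noncomputable def bound (k : ℕ) : ℝ := 16 - 8 * (1 / 2) ^ k

lemma bound_lt (k : ℕ) : bound k < 16 := by
  have : (0 : ℝ) < (1 / 2) ^ k := by positivity
  unfold bound; linarith

lemma eight_le_bound (k : ℕ) : 8 ≤ bound k := by
  have : (1 / 2 : ℝ) ^ k ≤ 1 := pow_le_one₀ (by norm_num) (by norm_num)
  unfold bound; linarith

/-- With `t = 2 ^ (-k)` the left side is `16 - 4 * t - 2 * t ^ 2`. This is the room needed to
restrict every item once per induction step. -/
lemma slack_mul_bound_le (k : ℕ) : (1 + slack k) * bound k ≤ bound (k + 1) := by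
  unfold bound slack
  have h1 : (1 / 2 : ℝ) ^ (k + 2) = (1 / 2) ^ k / 4 := by rw [pow_add]; ring
  have h2 : (1 / 2 : ℝ) ^ (k + 1) = (1 / 2) ^ k / 2 := by rw [pow_succ]; ring
  rw [h1, h2]
  have : (0 : ℝ) < (1 / 2) ^ k := by positivity
  nlinarith

/-! ### Selection of disjoint gaps -/

lemma exists_sorted {g : ℕ} {J : Finset ℕ} (h : g < J.card) :
    ∃ a : ℕ → ℕ, (∀ j ≤ g, a j ∈ J) ∧ (∀ j < g, a j < a (j + 1)) ∧
      (J.filter (· < a g)).card ≤ g := by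
  have hlt : ∀ j ≤ g, ∀ hf : (Set.ofPred (· ∈ J)).Finite, j < hf.toFinset.card := by
    intro j hj hf
    have : hf.toFinset = J := by ext; simp [Set.ofPred]
    rw [this]; omega
  refine ⟨Nat.nth (· ∈ J), fun j hj => Nat.nth_mem j (hlt j hj),
    fun j hj => Nat.nth_lt_nth' (Nat.lt_succ_self j) (hlt (j + 1) hj), ?_⟩
  have := Nat.count_nth (p := (· ∈ J)) (n := g) (hlt g le_rfl)
  rw [Nat.count_eq_card_filter_range] at this
  refine le_of_eq (Eq.trans ?_ this)
  congr 1
  ext x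
  simp [and_comm]

lemma sum_Ico_chain (v : ℕ → ℝ) (a : ℕ → ℕ) (g : ℕ) (ha : ∀ j < g, a j < a (j + 1)) :
    a 0 ≤ a g ∧ ∑ j ∈ Finset.range g, ∑ x ∈ Finset.Ico (a j) (a (j + 1)), v x =
      ∑ x ∈ Finset.Ico (a 0) (a g), v x := by
  induction g with
  | zero => simp
  | succ g ih =>
    obtain ⟨h1, h2⟩ := ih fun j hj => ha j (by omega)
    have h3 := ha g (by omega)
    refine ⟨by omega, ?_⟩
    rw [Finset.sum_range_succ, h2, Finset.sum_Ico_consecutive _ h1 h3.le]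

/-- Among `g` consecutive gaps, one carries at most the fraction `1 / g` of a given mass on the
integers. -/
lemma exists_light_gap {v : ℕ → ℝ} {W : ℝ} (hW : ∀ t : Finset ℕ, ∑ x ∈ t, v x ≤ W) {g : ℕ}
    (hg : 0 < g) {a : ℕ → ℕ} (ha : ∀ j < g, a j < a (j + 1)) :
    ∃ j < g, g * ∑ x ∈ Finset.Ico (a j) (a (j + 1)), v x ≤ W := by
  by_contra! hc
  have h1 : ∑ j ∈ Finset.range g, W < ∑ j ∈ Finset.range g,
      g * ∑ x ∈ Finset.Ico (a j) (a (j + 1)), v x :=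
    Finset.sum_lt_sum_of_nonempty (by simpa using hg.ne') fun j hj => hc j (Finset.mem_range.1 hj)
  rw [← Finset.mul_sum, (sum_Ico_chain v a g ha).2] at h1
  simp only [Finset.sum_const, Finset.card_range, nsmul_eq_mul] at h1
  have h2 : (0 : ℝ) < g := by exact_mod_cast hg
  have := hW (Finset.Ico (a 0) (a g))
  nlinarith

lemma chain_le {a : ℕ → ℕ} {g : ℕ} (ha : ∀ j < g, a j < a (j + 1)) {i j : ℕ} (hij : i ≤ j)
    (hj : j ≤ g) : a i ≤ a j := by
  induction j, hij using Nat.le_induction with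
  | base => exact le_rfl
  | succ n hn ih => exact (ih (by omega)).trans (ha n (by omega)).le

/-- Roberts's selection lemma: large finite sets of integers contain the end points of
consecutive disjoint gaps, one for each set, which may be taken light for a given mass. -/
lemma exists_gaps {ι : Type*} [DecidableEq ι] [Nonempty ι] {v : ℕ → ℝ} {W : ℝ}
    (hW : ∀ t : Finset ℕ, ∑ x ∈ t, v x ≤ W) {g : ℕ} (hg : 0 < g) (I : ι → Finset ℕ) (L : ℕ) :
    ∀ (S : ℕ) (s : Finset ι) (n₀ : ℕ), s.card = S →
      (∀ i ∈ s, S * (g + 1) ≤ ((I i).filter (n₀ ≤ ·)).card) →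
      ∃ (p : ℕ → ℕ) (e : ℕ → ι), Monotone p ∧ p 0 = n₀ ∧ L ≤ p (2 * S + 1) ∧
        (∀ i ∈ s, ∃ j < S, e j = i) ∧ ∀ j < S, e j ∈ s ∧ p (2 * j + 1) ∈ I (e j) ∧
          p (2 * j + 2) ∈ I (e j) ∧ p (2 * j + 1) < p (2 * j + 2) ∧
          g * ∑ x ∈ Finset.Ico (p (2 * j + 1)) (p (2 * j + 2)), v x ≤ W := by
  intro S
  induction S with
  | zero =>
    intro s n₀ hs _
    -- With no set left, the last interval is simply extended beyond `L`.
    refine ⟨fun r => if r = 0 then n₀ else max n₀ L, fun _ => Classical.arbitrary ι,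
      monotone_nat_of_le_succ fun n => ?_, by simp, by simp, ?_, by simp⟩
    · by_cases h : n = 0 <;> simp [h]
    · simp [Finset.card_eq_zero.1 hs]
  | succ S ih =>
    intro s n₀ hs hI
    have hcard : ∀ i ∈ s, g < ((I i).filter (n₀ ≤ ·)).card := fun i hi => by
      have := hI i hi
      rw [Nat.succ_mul] at this
      omega
    choose! a ha1 ha2 ha3 using fun i hi => exists_sorted (hcard i hi)
    have hne : s.Nonempty := Finset.card_pos.1 (by omega)
    -- Greedy choice: the set whose entry of index `g` comes earliest gets the first gap. Every
    -- other set loses at most `g` elements below it, which the budget of `g + 1` per set allows.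
    obtain ⟨i₀, hi₀, hmin⟩ := s.exists_min_image (fun i => a i g) hne
    obtain ⟨j₀, hj₀, hlight⟩ := exists_light_gap hW hg (ha2 i₀ hi₀)
    have hb1 : a i₀ (j₀ + 1) ≤ a i₀ g := chain_le (ha2 i₀ hi₀) hj₀ le_rfl
    have ha0 := ha1 i₀ hi₀ j₀ hj₀.le
    have ha0' := ha1 i₀ hi₀ (j₀ + 1) hj₀
    rw [Finset.mem_filter] at ha0 ha0'
    obtain ⟨p, e, hp, hp0, hpL, hsurj, hprop⟩ := ih (s.erase i₀) (a i₀ (j₀ + 1))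
      (by rw [Finset.card_erase_of_mem hi₀, hs]; rfl) (by
        intro i hi
        have his := Finset.mem_of_mem_erase hi
        have h1 := hI i his
        have h2 := ha3 i his
        have hsub : (I i).filter (n₀ ≤ ·) ⊆ (((I i).filter (n₀ ≤ ·)).filter (· < a i g)) ∪
            (I i).filter (a i₀ (j₀ + 1) ≤ ·) := by
          intro x hx
          simp only [Finset.mem_union, Finset.mem_filter] at hx ⊢
          by_cases hxa : x < a i g
          · exact Or.inl ⟨hx, hxa⟩
          · exact Or.inr ⟨hx.1, hb1.trans ((hmin i his).trans (not_lt.1 hxa))⟩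
        have h3 := (Finset.card_le_card hsub).trans (Finset.card_union_le _ _)
        rw [Nat.succ_mul] at h1
        omega)
    -- The recursive sequence starts at the right end of the new gap, so `p 0` becomes `p' 2`.
    let p' : ℕ → ℕ := fun r => if r = 0 then n₀ else if r = 1 then a i₀ j₀ else p (r - 2)
    let e' : ℕ → ι := fun r => if r = 0 then i₀ else e (r - 1)
    have hp'0 : p' 0 = n₀ := rfl
    have hp'1 : p' 1 = a i₀ j₀ := rfl
    have hp'2 : ∀ r, p' (r + 2) = p r := fun r => by simp [p']
    have he'0 : e' 0 = i₀ := rfl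
    have he'1 : ∀ r, e' (r + 1) = e r := fun r => by simp [e']
    refine ⟨p', e', monotone_nat_of_le_succ fun n => ?_, rfl, ?_, ?_, ?_⟩
    · match n with
      | 0 => rw [hp'0, zero_add, hp'1]; exact ha0.2
      | 1 =>
        rw [hp'1, hp'2, hp0]
        exact (ha2 i₀ hi₀ j₀ hj₀).le
      | n + 2 =>
        rw [hp'2, show n + 2 + 1 = (n + 1) + 2 by ring, hp'2]
        exact hp (Nat.le_succ n)
    · rw [show 2 * (S + 1) + 1 = (2 * S + 1) + 2 by ring, hp'2]
      exact hpL
    · intro i hi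
      by_cases h : i = i₀
      · exact ⟨0, by omega, by rw [he'0, h]⟩
      · obtain ⟨j, hj, hji⟩ := hsurj i (Finset.mem_erase.2 ⟨h, hi⟩)
        exact ⟨j + 1, by omega, by rw [he'1, hji]⟩
    · intro j hj
      match j with
      | 0 =>
        have h2 : p' (2 * 0 + 2) = a i₀ (j₀ + 1) := by rw [mul_zero, hp'2, hp0]
        rw [he'0, h2, mul_zero, zero_add, hp'1]
        exact ⟨hi₀, ha0.1, ha0'.1, ha2 i₀ hi₀ j₀ hj₀, hlight⟩
      | j + 1 =>
        rw [he'1, show 2 * (j + 1) + 1 = (2 * j + 1) + 2 by ring,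
          show 2 * (j + 1) + 2 = (2 * j + 2) + 2 by ring, hp'2, hp'2]
        obtain ⟨h1, h2⟩ := hprop j (by omega)
        exact ⟨Finset.mem_of_mem_erase h1, h2⟩

/-! ### The underlying product space -/

/-- The product of the finite sets `Fin (n + 1)`. -/
abbrev Seq : Type := ∀ n : ℕ, Fin (n + 1)

/-- The sequence that follows `z` at places below `m` and `y` from `m` on. -/
def splice (m : ℕ) (z y : Seq) : Seq := fun i => if i < m then z i else y i

/-- Two sequences agree at all places below `n`. -/
def Agree (n : ℕ) (x y : Seq) : Prop := ∀ i < n, x i = y i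

/-- The smallest set containing `X` that is determined by the coordinates below `n`. -/
def hull (n : ℕ) (X : Set Seq) : Set Seq := {y | ∃ x ∈ X, Agree n x y}

/-- `X` is determined by the coordinates below `n`. -/
def Dep (n : ℕ) (X : Set Seq) : Prop := ∀ x y, Agree n x y → x ∈ X → y ∈ X

/-- Membership in `X` does not depend on the coordinates below `m`. -/
def Inv (m : ℕ) (X : Set Seq) : Prop := ∀ z y, splice m z y ∈ X ↔ y ∈ X

lemma Agree.symm {n : ℕ} {x y : Seq} (h : Agree n x y) : Agree n y x := fun i hi => (h i hi).symm

lemma Agree.trans {n : ℕ} {x y z : Seq} (h : Agree n x y) (h' : Agree n y z) : Agree n x z :=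
  fun i hi => (h i hi).trans (h' i hi)

lemma Agree.mono {m n : ℕ} (hmn : m ≤ n) {x y : Seq} (h : Agree n x y) : Agree m x y :=
  fun i hi => h i (hi.trans_le hmn)

lemma agree_refl (n : ℕ) (x : Seq) : Agree n x x := fun _ _ => rfl

lemma agree_splice (m : ℕ) (z y : Seq) : Agree m z (splice m z y) := fun i hi => by
  simp [splice, hi]

lemma agree_splice_of_agree {n : ℕ} (m : ℕ) {y y' : Seq} (z : Seq) (h : Agree n y y') :
    Agree n (splice m z y) (splice m z y') := fun i hi => by
  simp [splice, h i hi]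

lemma splice_splice (m : ℕ) (z z' y : Seq) : splice m z (splice m z' y) = splice m z y := by
  funext i; unfold splice; split_ifs <;> rfl

lemma splice_eq_of_agree {m : ℕ} {z y : Seq} (h : Agree m z y) : splice m z y = y := by
  funext i; unfold splice; split_ifs with hi
  · exact h i hi
  · rfl

lemma subset_hull (n : ℕ) (X : Set Seq) : X ⊆ hull n X := fun x hx => ⟨x, hx, agree_refl n x⟩

lemma hull_mono (n : ℕ) {X Y : Set Seq} (h : X ⊆ Y) : hull n X ⊆ hull n Y :=
  fun _ ⟨x, hx, hxy⟩ => ⟨x, h hx, hxy⟩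

lemma hull_anti {m n : ℕ} (h : m ≤ n) (X : Set Seq) : hull n X ⊆ hull m X :=
  fun _ ⟨x, hx, hxy⟩ => ⟨x, hx, hxy.mono h⟩

lemma dep_hull (n : ℕ) (X : Set Seq) : Dep n (hull n X) :=
  fun _ _ hxy ⟨u, hu, hux⟩ => ⟨u, hu, hux.trans hxy⟩

lemma Dep.mono {m n : ℕ} (h : m ≤ n) {X : Set Seq} (hX : Dep m X) : Dep n X :=
  fun x y hxy => hX x y (hxy.mono h)

lemma Dep.compl {n : ℕ} {X : Set Seq} (hX : Dep n X) : Dep n Xᶜ :=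
  fun x y hxy hx hy => hx (hX y x hxy.symm hy)

lemma Dep.union {n : ℕ} {X Y : Set Seq} (hX : Dep n X) (hY : Dep n Y) : Dep n (X ∪ Y) :=
  fun x y hxy => Or.imp (hX x y hxy) (hY x y hxy)

lemma Dep.iUnion {ι : Sort*} {n : ℕ} {X : ι → Set Seq} (hX : ∀ i, Dep n (X i)) :
    Dep n (⋃ i, X i) := fun x y hxy hx => by
  obtain ⟨i, hi⟩ := Set.mem_iUnion.1 hx
  exact Set.mem_iUnion.2 ⟨i, hX i x y hxy hi⟩

lemma Dep.splice_preimage {n : ℕ} {X : Set Seq} (hX : Dep n X) (m : ℕ) (z : Seq) :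
    Dep n (splice m z ⁻¹' X) := fun _ _ hxy => hX _ _ (agree_splice_of_agree m z hxy)

lemma inv_splice_preimage (m : ℕ) (z : Seq) (X : Set Seq) : Inv m (splice m z ⁻¹' X) :=
  fun z' y => by simp only [Set.mem_preimage, splice_splice]

lemma Inv.compl {m : ℕ} {X : Set Seq} (hX : Inv m X) : Inv m Xᶜ := fun z y => not_congr (hX z y)

lemma Inv.iUnion {ι : Sort*} {m : ℕ} {X : ι → Set Seq} (hX : ∀ i, Inv m (X i)) :
    Inv m (⋃ i, X i) := fun z y => by
  simp only [Set.mem_iUnion]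
  exact exists_congr fun i => hX i z y

lemma Inv.hull {m : ℕ} {X : Set Seq} (hX : Inv m X) (n : ℕ) : Inv m (hull n X) := by
  have key : ∀ z y, y ∈ VonNeumann.hull n X → splice m z y ∈ VonNeumann.hull n X :=
    fun z y ⟨x, hx, hxy⟩ => ⟨splice m z x, (hX z x).2 hx, agree_splice_of_agree m z hxy⟩
  intro z y
  refine ⟨fun h => ?_, key z y⟩
  have := key y _ h
  rwa [splice_splice, splice_eq_of_agree (agree_refl m y)] at this

/-- The trace of `X` on the coordinates in `[m, n)`, seen from the atom of `z`. -/
def trace (m n : ℕ) (z : Seq) (X : Set Seq) : Set Seq := hull n (splice m z ⁻¹' X)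

/-- If `u` were in `X`, replacing its first `m` coordinates by those of `y` would give a witness for
`y` in the trace, since the preimage ignores these coordinates. -/
lemma notMem_of_notMem_trace {m n : ℕ} {z y u : Seq} {X : Set Seq} (hy : y ∉ trace m n z X)
    (hu : Agree n (splice m z y) u) (hmn : m ≤ n) : u ∉ X := by
  intro huX
  refine hy ⟨splice m y u, ?_, ?_⟩
  · have : splice m z u = u := splice_eq_of_agree (((agree_splice m z y).trans (hu.mono hmn)))
    rwa [Set.mem_preimage, splice_splice, this]
  · intro i hi
    have := hu i hi
    unfold splice at this ⊢
    split_ifs at this ⊢ with h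
    · rfl
    · exact this.symm

/-- This lets thinness survive the restriction of an item to a block. -/
lemma trace_trace_subset {m n m' n' : ℕ} (hm : m ≤ m') (hmn : m' ≤ n') (hn : n' ≤ n) (z z' : Seq)
    (X : Set Seq) : trace m' n' z' (trace m n z X) ⊆ trace m' n' (splice m z z') X := by
  rintro y ⟨y', ⟨u, hu, huy⟩, hy⟩
  refine ⟨splice m' y u, ?_, ?_⟩
  · have : splice m' (splice m z z') (splice m' y u) = splice m z u := by
      funext i
      have := huy i
      unfold splice at this ⊢
      split_ifs at this ⊢ with h1 h2 h2
      · rfl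
      · exact (this (by omega)).symm
      · omega
      · rfl
    rw [Set.mem_preimage, this]
    exact hu
  · intro i hi
    have h1 := huy i (by omega)
    have h2 := hy i hi
    unfold splice at h1 ⊢
    split_ifs at h1 ⊢ with h
    · rfl
    · rw [h1, h2]

/-! ### Items and covers -/

/-- A set together with a level and a finite set of integers, which determine its weight. -/
structure Item where
  /-- The level. -/
  lvl : ℕ
  /-- The underlying set. -/
  set : Set Seq
  /-- The finite set of integers. -/
  idx : Finset ℕ

/-- The weight of an item. -/
noncomputable def Item.wt (x : Item) : ℝ := wgt x.lvl x.idx.card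

lemma Item.wt_pos (x : Item) : 0 < x.wt := wgt_pos _ _

/-- `Y` is covered by finitely many items from `C` with total weight less than `r`. -/
def Small (C : Set Item) (Y : Set Seq) (r : ℝ) : Prop :=
  ∃ F : Finset Item, (F : Set Item) ⊆ C ∧ (∀ y ∈ Y, ∃ x ∈ F, y ∈ x.set) ∧ ∑ x ∈ F, x.wt < r

lemma sum_wt_image_le {ι : Type*} [DecidableEq Item] (s : Finset ι) (f : ι → Item) :
    ∑ x ∈ s.image f, x.wt ≤ ∑ i ∈ s, (f i).wt :=
  Finset.sum_image_le_of_nonneg fun _ _ => (Item.wt_pos _).le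

lemma Small.mono {C D : Set Item} {X Y : Set Seq} {r t : ℝ} (h : Small C Y r) (hC : C ⊆ D)
    (hY : X ⊆ Y) (hr : r ≤ t) : Small D X t := by
  obtain ⟨F, h1, h2, h3⟩ := h
  exact ⟨F, h1.trans hC, fun y hy => h2 y (hY hy), h3.trans_le hr⟩

lemma small_empty (C : Set Item) {r : ℝ} (hr : 0 < r) : Small C ∅ r :=
  ⟨∅, by simp, by simp, by simpa using hr⟩

lemma Small.union {C : Set Item} {X Y : Set Seq} {r t : ℝ} (hX : Small C X r) (hY : Small C Y t) :
    Small C (X ∪ Y) (r + t) := by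
  classical
  obtain ⟨F, h1, h2, h3⟩ := hX
  obtain ⟨G, h4, h5, h6⟩ := hY
  refine ⟨F ∪ G, by simp [h1, h4], ?_, ?_⟩
  · rintro y (hy | hy)
    · obtain ⟨x, hx, hxy⟩ := h2 y hy
      exact ⟨x, Finset.mem_union_left _ hx, hxy⟩
    · obtain ⟨x, hx, hxy⟩ := h5 y hy
      exact ⟨x, Finset.mem_union_right _ hx, hxy⟩
  · have := Finset.sum_union_inter (s₁ := F) (s₂ := G) (f := Item.wt)
    have h7 : 0 ≤ ∑ x ∈ F ∩ G, x.wt := Finset.sum_nonneg fun x _ => x.wt_pos.le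
    linarith

lemma Small.biUnion {ι : Type*} {C : Set Item} {X : ι → Set Seq} {r : ℝ} (s : Finset ι)
    (h : ∀ i ∈ s, Small C (X i) r) {t : ℝ} (ht : 0 < t) :
    Small C (⋃ i ∈ s, X i) (s.card * r + t) := by
  classical
  induction s using Finset.induction_on with
  | empty => simpa using small_empty C ht
  | insert a s ha ih =>
    have := (h a (Finset.mem_insert_self a s)).union
      (ih fun i hi => h i (Finset.mem_insert_of_mem hi))
    rw [Finset.set_biUnion_insert, Finset.card_insert_of_notMem ha]
    refine this.mono le_rfl le_rfl (le_of_eq ?_)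
    push_cast
    ring

/-- From every atom at `m`, the trace of `X` on `[m, n)` leaves a set that is not small. -/
def ThinAt (C : Set Item) (X : Set Seq) (m n : ℕ) : Prop :=
  ∀ z, ¬ Small C (trace m n z X)ᶜ 1

lemma ThinAt.mono {C : Set Item} {X Y : Set Seq} {m n n' : ℕ} (h : ThinAt C X m n) (hY : Y ⊆ X)
    (hn : n ≤ n') : ThinAt C Y m n' := by
  intro z hz
  refine h z (hz.mono le_rfl (Set.compl_subset_compl.2 ?_) le_rfl)
  exact (hull_anti hn _).trans (hull_mono _ (Set.preimage_mono hY))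

lemma ThinAt.trace {C : Set Item} {X : Set Seq} {m n m' n' : ℕ} (h : ThinAt C X m' n')
    (hm : m ≤ m') (hmn : m' ≤ n') (hn : n' ≤ n) (z : Seq) :
    ThinAt C (VonNeumann.trace m n z X) m' n' := by
  intro z' hz'
  exact h (splice m z z')
    (hz'.mono le_rfl (Set.compl_subset_compl.2 (trace_trace_subset hm hmn hn z z' X)) le_rfl)

/-- Membership in the `p`-th approximation to Talagrand's family of items. -/
def Mem (p : ℕ) (x : Item) : Prop :=
  x.lvl ≤ p ∧ x.idx.Nonempty ∧ x.idx.card ≤ maxCard x.lvl ∧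
    ∀ m ∈ x.idx, ∀ n ∈ x.idx, m < n →
      ThinAt {y | ∃ _ : x.lvl < y.lvl ∧ y.lvl ≤ p, Mem p y} x.set m n
termination_by p - x.lvl

/-- The items of level at least `k` in the `p`-th approximation. -/
def stage (p k : ℕ) : Set Item := {x | k ≤ x.lvl ∧ Mem p x}

/-- The recursion climbs in level, and the cutoff `p` makes it terminate. The explicit clause `y.lvl
≤ p` is redundant afterwards. -/
lemma mem_iff {p : ℕ} {x : Item} : Mem p x ↔ x.lvl ≤ p ∧ x.idx.Nonempty ∧
    x.idx.card ≤ maxCard x.lvl ∧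
    ∀ m ∈ x.idx, ∀ n ∈ x.idx, m < n → ThinAt (stage p (x.lvl + 1)) x.set m n := by
  rw [Mem]
  have : {y : Item | ∃ _ : x.lvl < y.lvl ∧ y.lvl ≤ p, Mem p y} = stage p (x.lvl + 1) := by
    ext y
    simp only [Set.mem_ofPred_eq, stage, exists_prop]
    refine ⟨fun h => ⟨h.1.1, h.2⟩, fun h => ⟨⟨h.1, ?_⟩, h.2⟩⟩
    have := h.2
    rw [Mem] at this
    exact this.1
  rw [this]

lemma stage_anti (p : ℕ) {k l : ℕ} (h : k ≤ l) : stage p l ⊆ stage p k :=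
  fun _ hx => ⟨h.trans hx.1, hx.2⟩

/-- The restriction of an item to the coordinates in `[m, n)`, seen from the atom of `z`. -/
def Item.restrict (m n : ℕ) (z : Seq) (x : Item) : Item :=
  ⟨x.lvl, trace m n z x.set, x.idx.filter fun i => m ≤ i ∧ i < n⟩

/-- The family reproduces itself on blocks: gaps between indices inside `[m, n)` stay thin by
`ThinAt.trace`. -/
lemma restrict_mem {p k m n : ℕ} {z : Seq} {x : Item} (hx : x ∈ stage p k)
    (hne : (x.idx.filter fun i => m ≤ i ∧ i < n).Nonempty) :
    x.restrict m n z ∈ stage p k := by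
  obtain ⟨hk, hx⟩ := hx
  refine ⟨hk, ?_⟩
  rw [mem_iff] at hx ⊢
  obtain ⟨h1, h2, h3, h4⟩ := hx
  refine ⟨h1, hne, (Finset.card_le_card (Finset.filter_subset _ _)).trans h3, ?_⟩
  intro a ha b hb hab
  simp only [Item.restrict, Finset.mem_filter] at ha hb
  exact (h4 a ha.1 b hb.1 hab).trace ha.2.1 hab.le hb.2.2.le z

lemma restrict_wt_le {k m n : ℕ} {z : Seq} {x : Item} (hk : k ≤ x.lvl) (hne : x.idx.Nonempty)
    (h : x.idx.card ≤ shrink k * (x.idx.filter fun i => m ≤ i ∧ i < n).card) :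
    (x.restrict m n z).wt ≤ (1 + slack k) * x.wt :=
  wgt_le_of_shrink hk hne.card_pos h

/-! ### The main estimate -/

/-- Pigeonhole over `R ≤ q` consecutive blocks. -/
lemma exists_heavy_interval {b : ℕ → ℕ} {R q : ℕ} {J : Finset ℕ} (hJ : ∀ i ∈ J, b 0 ≤ i ∧ i < b R)
    (hR : R ≤ q) (hR0 : 0 < R) :
    ∃ r < R, J.card ≤ q * (J.filter fun i => b r ≤ i ∧ i < b (r + 1)).card := by
  by_contra! hc
  have hsub : J ⊆ (Finset.range R).biUnion fun r => J.filter fun i => b r ≤ i ∧ i < b (r + 1) := by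
    intro i hi
    obtain ⟨h0, h1⟩ := hJ i hi
    have hex : ∃ r, i < b r := ⟨R, h1⟩
    have hle : Nat.find hex ≤ R := Nat.find_min' hex h1
    have hpos : 0 < Nat.find hex := by
      rw [Nat.find_pos]
      omega
    have hlt := Nat.find_min hex (m := Nat.find hex - 1) (by omega)
    have hsp := Nat.find_spec hex
    rw [Finset.mem_biUnion]
    refine ⟨Nat.find hex - 1, by rw [Finset.mem_range]; omega, ?_⟩
    rw [Finset.mem_filter, Nat.sub_add_cancel hpos]
    exact ⟨hi, not_lt.1 hlt, hsp⟩
  have h1 := (Finset.card_le_card hsub).trans Finset.card_biUnion_le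
  have h2 : ∑ r ∈ Finset.range R, q * (J.filter fun i => b r ≤ i ∧ i < b (r + 1)).card <
      ∑ _r ∈ Finset.range R, J.card :=
    Finset.sum_lt_sum_of_nonempty (by simpa using hR0.ne') fun r hr =>
      hc r (Finset.mem_range.1 hr)
  rw [← Finset.mul_sum, Finset.sum_const, Finset.card_range, smul_eq_mul] at h2
  have h3 := Nat.mul_le_mul_left q h1
  have h4 := Nat.mul_le_mul_right J.card hR
  omega

/-- Each `P r` is secured by coordinates below `b (r + 1)`, so later choices cannot spoil it. -/
lemma exists_of_steps {b : ℕ → ℕ} (hb : Monotone b) {R : ℕ} {P : ℕ → Seq → Prop}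
    (h : ∀ r < R, ∀ z, ∃ y, ∀ u, Agree (b (r + 1)) (splice (b r) z y) u → P r u) (z₀ : Seq) :
    ∃ z, Agree (b 0) z₀ z ∧ ∀ u, Agree (b R) z u → ∀ r < R, P r u := by
  induction R with
  | zero => exact ⟨z₀, agree_refl _ _, fun u _ r hr => absurd hr (Nat.not_lt_zero r)⟩
  | succ R ih =>
    obtain ⟨z, hz0, hz⟩ := ih fun r hr => h r (by omega)
    obtain ⟨y, hy⟩ := h R (Nat.lt_succ_self R) z
    refine ⟨splice (b R) z y,
      hz0.trans ((agree_splice (b R) z y).mono (hb (Nat.zero_le R))), fun u hu r hr => ?_⟩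
    rcases Nat.lt_succ_iff_lt_or_eq.1 hr with hr | rfl
    · exact hz u ((agree_splice (b R) z y).trans (hu.mono (hb (Nat.le_succ R)))) r hr
    · exact hy u hu

/-- Otherwise the restrictions to `[m, n)`, which are again items and cost only the factor `1 +
slack j`, would cover `Y`. -/
lemma exists_notMem_trace {p j k m n : ℕ} (hjk : j ≤ k) {F : Finset Item}
    (hF : ∀ x ∈ F, x ∈ stage p k)
    (hcard : ∀ x ∈ F, x.idx.card ≤ shrink j * (x.idx.filter fun i => m ≤ i ∧ i < n).card)
    {Y : Set Seq} {t : ℝ} (hY : ¬ Small (stage p k) Y t)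
    (hw : (1 + slack j) * ∑ x ∈ F, x.wt < t) (z : Seq) :
    ∃ y ∈ Y, ∀ x ∈ F, y ∉ trace m n z x.set := by
  classical
  by_contra! hc
  have hne : ∀ x ∈ F, x.idx.Nonempty := fun x hx => (mem_iff.1 (hF x hx).2).2.1
  refine hY ⟨F.image (Item.restrict m n z), ?_, ?_, ?_⟩
  · intro y hy
    obtain ⟨x, hx, rfl⟩ := Finset.mem_image.1 (Finset.mem_coe.1 hy)
    refine restrict_mem (hF x hx) (Finset.card_pos.1 ?_)
    have h1 := (hne x hx).card_pos
    have h2 := hcard x hx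
    exact Nat.pos_of_ne_zero fun h => by rw [h] at h2; omega
  · intro y hy
    obtain ⟨x, hx, hxy⟩ := hc y hy
    exact ⟨_, Finset.mem_image_of_mem _ hx, hxy⟩
  · refine lt_of_le_of_lt ((sum_wt_image_le F _).trans ?_) hw
    rw [Finset.mul_sum]
    exact Finset.sum_le_sum fun x hx =>
      restrict_wt_le (hjk.trans (hF x hx).1) (hne x hx) (hcard x hx)

lemma minCard_le_card {p k : ℕ} {x : Item} (hx : x ∈ stage p k) (hw : x.wt < 16) :
    minCard x.lvl ≤ x.idx.card :=
  minCard_le_of_wgt_lt (mem_iff.1 hx.2).2.1.card_pos hw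

/-- The mass on the integers which distributes the weight of each item over its index set. -/
noncomputable def mass (F : Finset Item) (a : ℕ) : ℝ :=
  ∑ x ∈ F, if a ∈ x.idx then x.wt / x.idx.card else 0

lemma sum_mass (F : Finset Item) (t : Finset ℕ) :
    ∑ a ∈ t, mass F a = ∑ x ∈ F, (t.filter (· ∈ x.idx)).card * (x.wt / x.idx.card) := by
  unfold mass
  rw [Finset.sum_comm]
  refine Finset.sum_congr rfl fun x _ => ?_
  rw [← Finset.sum_filter, Finset.sum_const, nsmul_eq_mul]

lemma sum_mass_le (F : Finset Item) (t : Finset ℕ) : ∑ a ∈ t, mass F a ≤ ∑ x ∈ F, x.wt := by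
  rw [sum_mass]
  refine Finset.sum_le_sum fun x _ => ?_
  have h1 : (t.filter (· ∈ x.idx)).card ≤ x.idx.card :=
    Finset.card_le_card fun i hi => (Finset.mem_filter.1 hi).2
  rcases Nat.eq_zero_or_pos x.idx.card with h0 | h0
  · rw [h0]; simpa using x.wt_pos.le
  · have h2 : (0 : ℝ) < x.idx.card := by exact_mod_cast h0
    have h3 : ((t.filter (· ∈ x.idx)).card : ℝ) ≤ x.idx.card := by exact_mod_cast h1
    rw [mul_div_assoc', div_le_iff₀ h2, mul_comm]
    exact mul_le_mul_of_nonneg_left h3 x.wt_pos.le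

/-- An item with a fraction `1 / q` of its indices in the block puts the same fraction of its weight
there. -/
lemma sum_wt_le_sum_mass {F G : Finset Item} (hG : G ⊆ F) {q m n : ℕ}
    (hne : ∀ x ∈ G, x.idx.Nonempty)
    (hcard : ∀ x ∈ G, x.idx.card ≤ q * (x.idx.filter fun i => m ≤ i ∧ i < n).card) :
    ∑ x ∈ G, x.wt ≤ q * ∑ a ∈ Finset.Ico m n, mass F a := by
  rw [sum_mass, Finset.mul_sum]
  calc ∑ x ∈ G, x.wt ≤ ∑ x ∈ G, (q : ℝ) * (((Finset.Ico m n).filter (· ∈ x.idx)).card *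
        (x.wt / x.idx.card)) := by
        refine Finset.sum_le_sum fun x hx => ?_
        have h0 : (0 : ℝ) < x.idx.card := by exact_mod_cast (hne x hx).card_pos
        have h1 : (x.idx.card : ℝ) ≤ q * ((Finset.Ico m n).filter (· ∈ x.idx)).card := by
          have : (Finset.Ico m n).filter (· ∈ x.idx) = x.idx.filter fun i => m ≤ i ∧ i < n := by
            ext i; simp [and_comm]
          rw [this]
          exact_mod_cast hcard x hx
        rw [← mul_assoc, mul_div_assoc', le_div_iff₀ h0, mul_comm]
        exact mul_le_mul_of_nonneg_right h1 x.wt_pos.le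
    _ ≤ _ := Finset.sum_le_sum_of_subset_of_nonneg hG fun x _ _ => by
        have := x.wt_pos
        positivity

lemma card_le_of_sum_wt_lt {F : Finset Item} {k : ℕ} (hF : ∀ x ∈ F, x.lvl = k)
    (hw : ∑ x ∈ F, x.wt < 16) : F.card ≤ 2 ^ (k + 4) := by
  have h1 : (F.card : ℝ) * (1 / 2) ^ k ≤ ∑ x ∈ F, x.wt := by
    rw [← nsmul_eq_mul]
    refine Finset.card_nsmul_le_sum _ _ _ fun x hx => ?_
    rw [← hF x hx]
    exact pow_le_wgt _ _
  have h2 : (F.card : ℝ) ≤ 2 ^ (k + 4) := by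
    have h3 : (1 / 2 : ℝ) ^ k * 2 ^ k = 1 := by rw [← mul_pow]; norm_num
    have h4 : (0 : ℝ) < 2 ^ k := by positivity
    rw [pow_add]
    calc (F.card : ℝ) = F.card * (1 / 2) ^ k * 2 ^ k := by rw [mul_assoc, h3, mul_one]
      _ ≤ 16 * 2 ^ k := mul_le_mul_of_nonneg_right (h1.trans hw.le) h4.le
      _ = 2 ^ k * 2 ^ 4 := by ring
  exact_mod_cast h2

/-- A bound for all members of the index sets of finitely many items. -/
noncomputable def idxBound (F : Finset Item) : ℕ := F.sup (fun x => x.idx.sup id) + 1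

lemma lt_idxBound {F : Finset Item} {x : Item} (hx : x ∈ F) {i : ℕ} (hi : i ∈ x.idx) :
    i < idxBound F := by
  have h1 : i ≤ x.idx.sup id := Finset.le_sup (f := id) hi
  have h2 : x.idx.sup id ≤ F.sup fun x => x.idx.sup id :=
    Finset.le_sup (f := fun x : Item => x.idx.sup id) hx
  unfold idxBound
  omega

/-- Items of level at least `k` with total weight less than `bound k` do not cover the space. -/
theorem not_small_univ (p k : ℕ) : ¬ Small (stage p k) Set.univ (bound k) := by
  classical
  -- Downward induction on the level: no item has level above `p`.
  obtain ⟨d, hd⟩ : ∃ d, p + 1 ≤ k + d := ⟨p + 1, by omega⟩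
  induction d generalizing k with
  | zero =>
    rintro ⟨F, hF, hcov, -⟩
    obtain ⟨x, hx, -⟩ := hcov (fun i => 0) trivial
    obtain ⟨h1, h2⟩ := hF hx
    have := (mem_iff.1 h2).1
    omega
  | succ d ih =>
    specialize ih (k + 1) (by omega)
    rintro ⟨F, hF, hcov, hw⟩
    have hw16 := hw.trans (bound_lt k)
    have hmem : ∀ x ∈ F, x ∈ stage p k := fun x hx => hF hx
    have hwt : ∀ x ∈ F, x.wt < 16 := fun x hx => lt_of_le_of_lt
      (Finset.single_le_sum (f := Item.wt) (fun y _ => y.wt_pos.le) hx) hw16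
    set s₀ := F.filter fun x => x.lvl = k with hs₀
    set s₁ := F.filter fun x => k + 1 ≤ x.lvl with hs₁
    have hs₀F : s₀ ⊆ F := Finset.filter_subset _ _
    have hs₁F : s₁ ⊆ F := Finset.filter_subset _ _
    have hsub_le : ∀ G ⊆ F, ∑ x ∈ G, x.wt ≤ ∑ x ∈ F, x.wt := fun G hG =>
      Finset.sum_le_sum_of_subset_of_nonneg hG fun x _ _ => x.wt_pos.le
    have hS : s₀.card ≤ 2 ^ (k + 4) := card_le_of_sum_wt_lt
      (fun x hx => (Finset.mem_filter.1 hx).2) ((hsub_le _ hs₀F).trans_lt hw16)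
    -- The gaps and the intervals around them make `2 * s₀.card + 1` blocks; this bound allows the
    -- pigeonhole.
    have hqS : 2 * s₀.card + 1 ≤ shrink k := by
      have h1 : shrink k = 4 * 2 ^ (k + 4) := by unfold shrink; ring
      have h2 : 0 < 2 ^ (k + 4) := by positivity
      omega
    -- `minCard k` factors as `2 ^ (k + 4)`, for the number of items, times `2 ^ (k + 12)`, for the
    -- `32 * shrink k + 1` indices each may consume.
    have hbig : ∀ x ∈ s₀, s₀.card * (32 * shrink k + 1) ≤
        (x.idx.filter (0 ≤ ·)).card := by
      intro x hx
      have h1 := minCard_le_card (hmem x (hs₀F hx)) (hwt x (hs₀F hx))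
      rw [(Finset.mem_filter.1 hx).2] at h1
      simp only [Nat.zero_le, Finset.filter_true]
      refine le_trans ?_ h1
      calc s₀.card * (32 * shrink k + 1) ≤ 2 ^ (k + 4) * 2 ^ (k + 12) := by
            refine Nat.mul_le_mul hS ?_
            have : 0 < 2 ^ k := by positivity
            unfold shrink
            rw [pow_add, pow_add]
            omega
        _ = minCard k := by unfold minCard; ring
    have : Nonempty Item := ⟨⟨0, ∅, ∅⟩⟩
    have hg : 0 < 32 * shrink k := by unfold shrink; positivity
    -- The higher items have total mass below 16, so a gap carries less than `1 / (2 * shrink k)`.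
    -- The items assigned to it then weigh less than `1 / 2`, and after restriction still less than
    -- 1.
    obtain ⟨b, e, hbmono, hb0, hbL, hsurj, hgap⟩ := exists_gaps (v := mass s₁) (sum_mass_le s₁) hg
      Item.idx (idxBound F) s₀.card s₀ 0 rfl hbig
    have hassign : ∀ x ∈ s₁, ∃ r < 2 * s₀.card + 1,
        x.idx.card ≤ shrink k * (x.idx.filter fun i => b r ≤ i ∧ i < b (r + 1)).card := by
      intro x hx
      exact exists_heavy_interval
        (fun i hi => ⟨by omega, (lt_idxBound (hs₁F hx) hi).trans_le hbL⟩) hqS (by omega)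
    choose! ρ hρ1 hρ2 using hassign
    have hstep : ∀ r < 2 * s₀.card + 1, ∀ z, ∃ y, ∀ u,
        Agree (b (r + 1)) (splice (b r) z y) u →
          (∀ x ∈ s₁, ρ x = r → u ∉ x.set) ∧ ∀ j < s₀.card, r = 2 * j + 1 → u ∉ (e j).set := by
      intro r hr z
      have hG1 : s₁.filter (fun x => ρ x = r) ⊆ s₁ := Finset.filter_subset _ _
      have hGmem : ∀ x ∈ s₁.filter (fun x => ρ x = r), x ∈ stage p (k + 1) := fun x hx =>
        ⟨(Finset.mem_filter.1 (hG1 hx)).2, (hmem x (hs₁F (hG1 hx))).2⟩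
      have hGcard : ∀ x ∈ s₁.filter (fun x => ρ x = r), x.idx.card ≤
          shrink k * (x.idx.filter fun i => b r ≤ i ∧ i < b (r + 1)).card := by
        intro x hx
        have := hρ2 x (hG1 hx)
        rwa [(Finset.mem_filter.1 hx).2] at this
      have hsl := slack_pos k
      have hsl4 := slack_le k
      -- Odd blocks are the gaps. There thinness of the level `k` item leaves a set too large for
      -- the assigned higher items to cover.
      by_cases hodd : ∃ j < s₀.card, r = 2 * j + 1
      · obtain ⟨j, hj, rfl⟩ := hodd
        obtain ⟨he, hb1, hb2, hb12, hlight⟩ := hgap j hj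
        have hthin := (mem_iff.1 (hmem _ (hs₀F he)).2).2.2.2 _ hb1 _ hb2 hb12
        rw [(Finset.mem_filter.1 he).2] at hthin
        have hle := sum_wt_le_sum_mass hG1
          (fun x hx => (mem_iff.1 (hGmem x hx).2).2.1) hGcard
        have hlt : ∑ x ∈ s₁, x.wt < 16 := (hsub_le _ hs₁F).trans_lt hw16
        push_cast at hlight
        obtain ⟨y, hy1, hy2⟩ := exists_notMem_trace (Nat.le_succ k) hGmem hGcard (hthin z)
          (by nlinarith) z
        refine ⟨y, fun u hu => ⟨fun x hx hxr => ?_, fun j' _ hj' => ?_⟩⟩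
        · exact notMem_of_notMem_trace (hy2 x (Finset.mem_filter.2 ⟨hx, hxr⟩)) hu hb12.le
        · obtain rfl : j = j' := by omega
          exact notMem_of_notMem_trace hy1 hu hb12.le
      · push Not at hodd
        -- Outside the gaps only higher items must be evaded, and the induction hypothesis at level
        -- `k + 1` absorbs the factor `1 + slack k`.
        obtain ⟨y, -, hy⟩ := exists_notMem_trace (Nat.le_succ k) hGmem hGcard ih
          (lt_of_lt_of_le (mul_lt_mul_of_pos_left
            ((hsub_le _ (hG1.trans hs₁F)).trans_lt hw) (by linarith)) (slack_mul_bound_le k)) z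
        refine ⟨y, fun u hu => ⟨fun x hx hxr => ?_, fun j hj hrj => absurd hrj (hodd j hj)⟩⟩
        exact notMem_of_notMem_trace (hy x (Finset.mem_filter.2 ⟨hx, hxr⟩)) hu
          (hbmono (Nat.le_succ r))
    obtain ⟨z, -, hz⟩ := exists_of_steps hbmono hstep (fun i => 0)
    replace hz := hz z (agree_refl _ _)
    obtain ⟨x, hx, hxz⟩ := hcov z trivial
    rcases Nat.eq_or_lt_of_le (hmem x hx).1 with h | h
    · obtain ⟨j, hj, hjx⟩ := hsurj x (Finset.mem_filter.2 ⟨hx, h.symm⟩)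
      exact (hz (2 * j + 1) (by omega)).2 j hj rfl (hjx ▸ hxz)
    · have hx1 : x ∈ s₁ := Finset.mem_filter.2 ⟨hx, h⟩
      exact (hz (ρ x) (hρ1 x hx1)).1 x hx1 rfl hxz

/-! ### Splitting covers -/

/-- Restriction raises a weight below 4 to at most 5, short of the 8 needed to cover everything. -/
lemma exists_avoiding {p k m n : ℕ} (hmn : m ≤ n) {F : Finset Item}
    (hF : ∀ x ∈ F, x ∈ stage p k) (hw : ∑ x ∈ F, x.wt < 4)
    (hcard : ∀ x ∈ F, x.idx.card ≤ shrink 0 * (x.idx.filter fun i => m ≤ i ∧ i < n).card)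
    (z : Seq) : ∃ y, ∀ u, Agree n (splice m z y) u → ∀ x ∈ F, u ∉ x.set := by
  have h1 := slack_le 0
  have h2 := slack_pos 0
  have h3 := eight_le_bound k
  have h4 : 0 ≤ ∑ x ∈ F, x.wt := Finset.sum_nonneg fun x _ => x.wt_pos.le
  obtain ⟨y, -, hy⟩ := exists_notMem_trace (Nat.zero_le k) hF hcard (not_small_univ p k)
    (by nlinarith) z
  exact ⟨y, fun u hu x hx => notMem_of_notMem_trace (hy x hx) hu hmn⟩

lemma exists_three_way (F : Finset Item) (m n : ℕ) :
    ∃ (L : ℕ) (ρ : Item → ℕ), n ≤ L ∧ (∀ x ∈ F, ρ x = 0 ∨ ρ x = 1 ∨ ρ x = 2) ∧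
      (∀ x ∈ F, ρ x = 0 →
        x.idx.card ≤ shrink 0 * (x.idx.filter fun i => 0 ≤ i ∧ i < m).card) ∧
      (∀ x ∈ F, ρ x = 1 →
        x.idx.card ≤ shrink 0 * (x.idx.filter fun i => m ≤ i ∧ i < n).card) ∧
      (∀ x ∈ F, ρ x = 2 →
        x.idx.card ≤ shrink 0 * (x.idx.filter fun i => n ≤ i ∧ i < L).card) := by
  let b : ℕ → ℕ := fun r =>
    if r = 0 then 0 else if r = 1 then m else if r = 2 then n else max n (idxBound F)
  have h : ∀ x ∈ F, ∃ r < 3,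
      x.idx.card ≤ shrink 0 * (x.idx.filter fun i => b r ≤ i ∧ i < b (r + 1)).card := by
    intro x hx
    refine exists_heavy_interval (fun i hi => ⟨Nat.zero_le i, ?_⟩)
      (by unfold shrink; norm_num) (by norm_num)
    exact lt_of_lt_of_le (lt_idxBound hx hi) (le_max_right _ _)
  choose! ρ h1 h2 using h
  refine ⟨max n (idxBound F), ρ, le_max_left _ _, fun x hx => ?_, fun x hx hr => ?_,
    fun x hx hr => ?_, fun x hx hr => ?_⟩
  · have := h1 x hx
    omega
  all_goals
    have := h2 x hx
    rw [hr] at this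
    exact this

lemma sum_wt_filter_le (F : Finset Item) (P : Item → Prop) [DecidablePred P] :
    ∑ x ∈ F.filter P, x.wt ≤ ∑ x ∈ F, x.wt :=
  Finset.sum_le_sum_of_subset_of_nonneg (Finset.filter_subset _ _) fun x _ _ => x.wt_pos.le

/-- A small set which depends on the coordinates in `[m, n)` only has a cover by such sets. -/
lemma exists_localized_cover {p k m n : ℕ} (hmn : m ≤ n) {Y : Set Seq} (hdep : Dep n Y)
    (hinv : Inv m Y) (hY : Small (stage p k) Y 1) :
    ∃ F : Finset Item, (∀ x ∈ F, x ∈ stage p k ∧ Dep n x.set ∧ Inv m x.set ∧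
        ∀ i ∈ x.idx, i < n) ∧
      (∀ y ∈ Y, ∃ x ∈ F, y ∈ x.set) ∧ ∑ x ∈ F, x.wt < 2 := by
  classical
  obtain ⟨F, hF, hcov, hw⟩ := hY
  obtain ⟨L, ρ, hnL, hρ, hρ0, hρ1, hρ2⟩ := exists_three_way F m n
  have hsub : ∀ r, ∑ x ∈ F.filter (fun x => ρ x = r), x.wt < 1 := fun r =>
    (sum_wt_filter_le F _).trans_lt hw
  have hmem : ∀ r, ∀ x ∈ F.filter (fun x => ρ x = r), x ∈ stage p k := fun r x hx =>
    hF (Finset.mem_filter.1 hx).1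
  -- The first `m` coordinates are fixed so as to evade all items living mainly below `m`; the
  -- middle items are then viewed from this atom.
  obtain ⟨y₀, hy₀⟩ := exists_avoiding (Nat.zero_le m) (hmem 0) ((hsub 0).trans (by norm_num))
    (fun x hx => hρ0 x (Finset.mem_filter.1 hx).1 (Finset.mem_filter.1 hx).2) (fun _ => 0)
  set z := splice 0 (fun _ => 0) y₀
  have hne : ∀ x ∈ F, x.idx.Nonempty := fun x hx => (mem_iff.1 (hF hx).2).2.1
  have hne1 : ∀ x ∈ F, ρ x = 1 → (x.idx.filter fun i => m ≤ i ∧ i < n).Nonempty := by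
    intro x hx hr
    have h1 := (hne x hx).card_pos
    have h2 := hρ1 x hx hr
    refine Finset.card_pos.1 (Nat.pos_of_ne_zero fun h => ?_)
    rw [h] at h2
    omega
  refine ⟨(F.filter fun x => ρ x = 1).image (Item.restrict m n z), ?_, ?_, ?_⟩
  · intro x' hx'
    obtain ⟨x, hx, rfl⟩ := Finset.mem_image.1 hx'
    obtain ⟨hxF, hr⟩ := Finset.mem_filter.1 hx
    refine ⟨restrict_mem (hF hxF) (hne1 x hxF hr), dep_hull _ _,
      (inv_splice_preimage m z x.set).hull n, fun i hi => ?_⟩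
    exact (Finset.mem_filter.1 hi).2.2
  · intro y hy
    by_contra! hc
    -- An uncovered `y` extends beyond `n` to evade the late items as well. The resulting point
    -- stays in `Y`, as `Y` only sees `[m, n)`, yet no item of `F` contains it.
    obtain ⟨y₂, hy₂⟩ := exists_avoiding hnL (hmem 2) ((hsub 2).trans (by norm_num))
      (fun x hx => hρ2 x (Finset.mem_filter.1 hx).1 (Finset.mem_filter.1 hx).2) (splice m z y)
    have hu := agree_splice n (splice m z y) y₂
    set u := splice n (splice m z y) y₂
    obtain ⟨x, hx, hxu⟩ := hcov u (hdep _ _ hu ((hinv z y).2 hy))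
    rcases hρ x hx with hr | hr | hr
    · exact hy₀ u ((agree_splice m z y).trans (hu.mono hmn)) x (Finset.mem_filter.2 ⟨hx, hr⟩) hxu
    · exact notMem_of_notMem_trace
        (hc _ (Finset.mem_image_of_mem _ (Finset.mem_filter.2 ⟨hx, hr⟩))) hu hmn hxu
    · exact hy₂ u (agree_refl _ _) x (Finset.mem_filter.2 ⟨hx, hr⟩) hxu
  · refine lt_of_le_of_lt (sum_wt_image_le _ _) ?_
    have h1 : ∑ x ∈ F.filter (fun x => ρ x = 1), (x.restrict m n z).wt ≤
        ∑ x ∈ F.filter (fun x => ρ x = 1), (1 + slack 0) * x.wt :=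
      Finset.sum_le_sum fun x hx =>
        have hx' := Finset.mem_filter.1 hx
        restrict_wt_le (Nat.zero_le _) (hne x hx'.1) (hρ1 x hx'.1 hx'.2)
    rw [← Finset.mul_sum] at h1
    have := hsub 1
    have h2 := slack_le 0
    have h3 := slack_pos 0
    have h4 : 0 ≤ ∑ x ∈ F.filter (fun x => ρ x = 1), x.wt :=
      Finset.sum_nonneg fun x _ => x.wt_pos.le
    nlinarith

/-- Fixing a single coordinate gives a set that is not small. -/
lemma not_small_coordinate (p k n : ℕ) (τ : Fin (n + 1)) :
    ¬ Small (stage p k) {z | z n = τ} 1 := by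
  classical
  rintro ⟨F, hF, hcov, hw⟩
  obtain ⟨L, ρ, hnL, hρ, hρ0, hρ1, hρ2⟩ := exists_three_way F n (n + 1)
  have hsub : ∀ r, ∑ x ∈ F.filter (fun x => ρ x = r), x.wt < 4 := fun r =>
    ((sum_wt_filter_le F _).trans_lt hw).trans (by norm_num)
  have hmem : ∀ r, ∀ x ∈ F.filter (fun x => ρ x = r), x ∈ stage p k := fun r x hx =>
    hF (Finset.mem_filter.1 hx).1
  obtain ⟨y₀, hy₀⟩ := exists_avoiding (Nat.zero_le n) (hmem 0) (hsub 0)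
    (fun x hx => hρ0 x (Finset.mem_filter.1 hx).1 (Finset.mem_filter.1 hx).2) (fun _ => 0)
  set z := splice 0 (fun _ => 0) y₀
  obtain ⟨y₂, hy₂⟩ := exists_avoiding hnL (hmem 2) (hsub 2)
    (fun x hx => hρ2 x (Finset.mem_filter.1 hx).1 (Finset.mem_filter.1 hx).2)
    (Function.update z n τ)
  have hu := agree_splice (n + 1) (Function.update z n τ) y₂
  set u := splice (n + 1) (Function.update z n τ) y₂
  have hun : u n = τ := by
    rw [← hu n (Nat.lt_succ_self n), Function.update_self]
  have hzu : Agree n z u := fun i hi => by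
    rw [← hu i (by omega), Function.update_of_ne hi.ne]
  obtain ⟨x, hx, hxu⟩ := hcov u hun
  rcases hρ x hx with hr | hr | hr
  · exact hy₀ u hzu x (Finset.mem_filter.2 ⟨hx, hr⟩) hxu
  · have h1 := hρ1 x hx hr
    have hxw : x.wt < 16 := lt_of_le_of_lt
      (Finset.single_le_sum (f := Item.wt) (fun y _ => y.wt_pos.le) hx) (hw.trans (by norm_num))
    have h2 := minCard_le_card (hF hx) hxw
    -- A block of length one holds at most one index, while an item with a `1 / 64` share there must
    -- have at least `2 ^ 16` indices: no middle item exists.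
    have h3 : (x.idx.filter fun i => n ≤ i ∧ i < n + 1).card ≤ 1 := by
      refine Finset.card_le_one.2 fun a ha b hb => ?_
      have ha' := (Finset.mem_filter.1 ha).2
      have hb' := (Finset.mem_filter.1 hb).2
      omega
    have h4 : 2 ^ 16 ≤ minCard x.lvl := Nat.pow_le_pow_right (by norm_num) (by omega)
    have h5 : shrink 0 = 2 ^ 6 := rfl
    rw [h5] at h1
    omega
  · exact hy₂ u (agree_refl _ _) x (Finset.mem_filter.2 ⟨hx, hr⟩) hxu

/-! ### The limit family -/

/-- The ultrafilter along which the approximations are taken to the limit. -/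
noncomputable abbrev lim : Ultrafilter ℕ := hyperfilter ℕ

/-- The items of level at least `k` that belong to almost all approximations. -/
def limStage (k : ℕ) : Set Item := {x | ∀ᶠ p in lim, x ∈ stage p k}

lemma eventually_subset_stage {k : ℕ} {F : Finset Item} (hF : ∀ x ∈ F, x ∈ limStage k) :
    ∀ᶠ p in lim, ∀ x ∈ F, x ∈ stage p k :=
  (Filter.eventually_all_finset F).2 hF

lemma limStage_anti {k l : ℕ} (h : k ≤ l) : limStage l ⊆ limStage k :=
  fun _ hx => hx.mono fun p hp => stage_anti p h hp

lemma Small.eventually {k : ℕ} {Y : Set Seq} {r : ℝ} (h : Small (limStage k) Y r) :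
    ∀ᶠ p in lim, Small (stage p k) Y r := by
  obtain ⟨F, hF, hcov, hw⟩ := h
  filter_upwards [eventually_subset_stage fun x hx => hF hx] with p hp
  exact ⟨F, fun x hx => hp x hx, hcov, hw⟩

/-- The items that live on the coordinates below `n`. -/
def localItems (n : ℕ) : Set Item := {x | x.lvl ≤ n ∧ Dep n x.set ∧ ∀ i ∈ x.idx, i < n}

lemma finite_dep (n : ℕ) : {X : Set Seq | Dep n X}.Finite := by
  let π : Seq → ∀ i : Fin n, Fin (i + 1) := fun z i => z i
  refine (Set.finite_range fun W : Set (∀ i : Fin n, Fin (i + 1)) => π ⁻¹' W).subset ?_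
  intro X hX
  refine ⟨π '' X, Set.Subset.antisymm ?_ (Set.subset_preimage_image _ _)⟩
  rintro y ⟨x, hx, hxy⟩
  exact hX x y (fun i hi => congrFun hxy ⟨i, hi⟩) hx

lemma finite_localItems (n : ℕ) : (localItems n).Finite := by
  refine (((Set.finite_Iic n).prod ((finite_dep n).prod
    (Finset.finite_toSet (Finset.range n).powerset))).image
      fun t : ℕ × Set Seq × Finset ℕ => Item.mk t.1 t.2.1 t.2.2).subset ?_
  rintro ⟨l, X, I⟩ ⟨h1, h2, h3⟩
  refine ⟨(l, X, I), ⟨h1, h2, ?_⟩, rfl⟩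
  exact Finset.mem_coe.2 (Finset.mem_powerset.2 fun i hi => Finset.mem_range.2 (h3 i hi))

/-- The level is bounded too, because the index set has at least `minCard x.lvl` elements, all below
`n`. -/
lemma mem_localItems {p k n : ℕ} {x : Item} (hx : x ∈ stage p k) (hw : x.wt < 16)
    (hdep : Dep n x.set) (hidx : ∀ i ∈ x.idx, i < n) : x ∈ localItems n := by
  refine ⟨?_, hdep, hidx⟩
  have h1 := minCard_le_card hx hw
  have h2 : x.idx.card ≤ n := by
    have : x.idx ⊆ Finset.range n := fun i hi => Finset.mem_range.2 (hidx i hi)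
    simpa using Finset.card_le_card this
  have h3 : x.lvl < 2 ^ x.lvl := Nat.lt_two_pow_self
  have h4 : 2 ^ x.lvl ≤ minCard x.lvl := Nat.pow_le_pow_right (by norm_num) (by omega)
  omega

lemma wt_lt_of_sum_lt {F : Finset Item} {x : Item} (hx : x ∈ F) {r : ℝ} (hw : ∑ x ∈ F, x.wt < r) :
    x.wt < r :=
  lt_of_le_of_lt (Finset.single_le_sum (f := Item.wt) (fun y _ => y.wt_pos.le) hx) hw

/-- The localized covers, one for each `p`, come from a finite collection, so the ultrafilter
singles out one that works for almost all `p`. -/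
lemma exists_limit_cover {k m n : ℕ} (hmn : m ≤ n) {Y : Set Seq} (hdep : Dep n Y)
    (hinv : Inv m Y) (hY : ∀ᶠ p in lim, Small (stage p k) Y 1) :
    ∃ F : Finset Item, (∀ x ∈ F, x ∈ limStage k ∧ Inv m x.set) ∧
      (∀ y ∈ Y, ∃ x ∈ F, y ∈ x.set) ∧ ∑ x ∈ F, x.wt < 2 := by
  classical
  have hfin := (finite_localItems n).toFinset.powerset.finite_toSet
  have hev : (⋃ F ∈ ((finite_localItems n).toFinset.powerset : Set (Finset Item)),
      {p | (∀ x ∈ F, x ∈ stage p k ∧ Inv m x.set) ∧ (∀ y ∈ Y, ∃ x ∈ F, y ∈ x.set) ∧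
        ∑ x ∈ F, x.wt < 2}) ∈ lim := by
    filter_upwards [hY] with p hp
    obtain ⟨F, h1, h2, h3⟩ := exists_localized_cover hmn hdep hinv hp
    refine Set.mem_biUnion (x := F) ?_ ⟨fun x hx => ⟨(h1 x hx).1, (h1 x hx).2.2.1⟩, h2, h3⟩
    refine Finset.mem_coe.2 (Finset.mem_powerset.2 fun x hx => ?_)
    rw [Set.Finite.mem_toFinset]
    obtain ⟨h4, h5, -, h6⟩ := h1 x hx
    exact mem_localItems h4 ((wt_lt_of_sum_lt hx h3).trans (by norm_num)) h5 h6
  obtain ⟨F, -, hF⟩ := (Ultrafilter.finite_biUnion_mem_iff hfin).1 hev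
  obtain ⟨p, hp⟩ := lim.nonempty_of_mem hF
  refine ⟨F, fun x hx => ⟨?_, (hp.1 x hx).2⟩, hp.2⟩
  filter_upwards [hF] with q hq
  exact (hq.1 x hx).1

/-! ### Exhaustivity -/

/-- The first place below which at least half of the index set of an item lies. -/
noncomputable def cut (x : Item) : ℕ :=
  sInf {n | x.idx.card ≤ 2 * (x.idx.filter fun i => 0 ≤ i ∧ i < n).card}

/-- The restriction of an item to the coordinates below its cut. -/
noncomputable def trunc (x : Item) : Item := x.restrict 0 (cut x) fun _ => 0

lemma card_le_cut (x : Item) :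
    x.idx.card ≤ 2 * (x.idx.filter fun i => 0 ≤ i ∧ i < cut x).card := by
  refine Nat.sInf_mem (s := {n | x.idx.card ≤ 2 * (x.idx.filter fun i => 0 ≤ i ∧ i < n).card})
    ⟨idxBound {x}, ?_⟩
  have : x.idx.filter (fun i => 0 ≤ i ∧ i < idxBound {x}) = x.idx :=
    Finset.filter_true_of_mem fun i hi =>
      ⟨Nat.zero_le i, lt_idxBound (Finset.mem_singleton_self x) hi⟩
  rw [Set.mem_ofPred_eq, this]
  omega

/-- By minimality of the cut, fewer than half of the indices lie below `n`. -/
lemma card_le_of_lt_cut {F : Finset Item} {x : Item} (hx : x ∈ F) {n : ℕ} (hn : n < cut x) :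
    x.idx.card ≤ 2 * (x.idx.filter fun i => n ≤ i ∧ i < max n (idxBound F)).card := by
  have h1 : ¬ x.idx.card ≤ 2 * (x.idx.filter fun i => 0 ≤ i ∧ i < n).card := fun h =>
    Nat.notMem_of_lt_sInf hn h
  have h2 : x.idx ⊆ (x.idx.filter fun i => 0 ≤ i ∧ i < n) ∪
      x.idx.filter fun i => n ≤ i ∧ i < max n (idxBound F) := by
    intro i hi
    have := lt_idxBound hx hi
    rw [Finset.mem_union, Finset.mem_filter, Finset.mem_filter]
    by_cases h : i < n
    · exact Or.inl ⟨hi, Nat.zero_le i, h⟩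
    · exact Or.inr ⟨hi, not_lt.1 h, lt_max_of_lt_right this⟩
  have h3 := (Finset.card_le_card h2).trans (Finset.card_union_le _ _)
  omega

lemma two_mul_le_shrink (k a : ℕ) : 2 * a ≤ shrink k * a := by
  refine Nat.mul_le_mul_right _ ?_
  unfold shrink
  calc 2 = 2 ^ 1 := rfl
    _ ≤ 2 ^ (k + 6) := Nat.pow_le_pow_right (by norm_num) (by omega)

lemma trunc_mem {p k : ℕ} {x : Item} (hx : x ∈ stage p k) : trunc x ∈ stage p k := by
  refine restrict_mem hx (Finset.card_pos.1 (Nat.pos_of_ne_zero fun h => ?_))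
  have h1 := (mem_iff.1 hx.2).2.1.card_pos
  have h2 := card_le_cut x
  omega

lemma trunc_mem_limStage {k : ℕ} {x : Item} (hx : x ∈ limStage k) : trunc x ∈ limStage k :=
  hx.mono fun _ => trunc_mem

lemma trunc_wt_le {p k : ℕ} {x : Item} (hx : x ∈ stage p k) : (trunc x).wt ≤ 2 * x.wt := by
  have h1 := restrict_wt_le (z := fun _ => 0) (Nat.zero_le x.lvl) (mem_iff.1 hx.2).2.1
    ((card_le_cut x).trans (two_mul_le_shrink 0 _))
  have h2 := slack_le 0
  have h3 := x.wt_pos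
  refine h1.trans ?_
  nlinarith

lemma splice_zero (z : Seq) : splice 0 z = id := by
  funext y i
  simp [splice]

lemma subset_trunc (x : Item) : x.set ⊆ (trunc x).set := by
  intro y hy
  refine subset_hull _ _ ?_
  rwa [splice_zero]

lemma dep_trunc (x : Item) : Dep (cut x) (trunc x).set := dep_hull _ _

lemma inv_trunc {m : ℕ} {x : Item} (hx : Inv m x.set) : Inv m (trunc x).set := by
  refine Inv.hull ?_ _
  rwa [splice_zero]

/-- If almost no finite union of the sets `Y i` is large, then there is a large set which meets
each `Y i` in a set of small submeasure. -/
lemma exists_large_of_unions_small {k m : ℕ} {Y : ℕ → Set Seq} (hdep : ∀ i, ∃ n, Dep n (Y i))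
    (hinv : ∀ i, Inv m (Y i))
    (hY : ∀ r, ∀ᶠ p in lim, Small (stage p k) (⋃ i ∈ Finset.range r, Y i) 1) {ε : ℝ} (hε : 0 < ε) :
    ∃ C : Set Seq, (∃ n, Dep n C) ∧ Inv m C ∧ (∀ᶠ p in lim, ¬ Small (stage p k) C 1) ∧
      ∀ i, Small (limStage k) (Y i ∩ C) ε := by
  classical
  have hcover : ∀ r, ∃ F : Finset Item, (∀ x ∈ F, x ∈ limStage k ∧ Inv m x.set) ∧
      (∀ y ∈ ⋃ i ∈ Finset.range r, Y i, ∃ x ∈ F, y ∈ x.set) ∧ ∑ x ∈ F, x.wt < 2 := by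
    intro r
    choose d hd using hdep
    refine exists_limit_cover (m := m) (n := max m ((Finset.range r).sup d)) (le_max_left _ _) ?_
      (Inv.iUnion fun i => Inv.iUnion fun _ => hinv i) (hY r)
    exact Dep.iUnion fun i => Dep.iUnion fun hi =>
      (hd i).mono ((Finset.le_sup (f := d) hi).trans (le_max_right _ _))
  choose F hF hcov hw using hcover
  have hstage : ∀ r, ∃ p, ∀ x ∈ F r, x ∈ stage p k := fun r =>
    (eventually_subset_stage fun x hx => (hF r x hx).1).exists
  -- The ultrafilter limit of the truncated covers of the growing unions.
  set G : Set Item := {y | ∀ᶠ r in lim, y ∈ (F r).image trunc} with hG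
  have hGF : ∀ y ∈ G, ∃ r, ∃ x ∈ F r, trunc x = y := fun y hy => by
    obtain ⟨r, hr⟩ := hy.exists
    exact ⟨r, by simpa using hr⟩
  have hsumF : ∀ r, ∑ y ∈ (F r).image trunc, y.wt < 4 := by
    intro r
    obtain ⟨p, hp⟩ := hstage r
    calc ∑ y ∈ (F r).image trunc, y.wt ≤ ∑ x ∈ F r, (trunc x).wt := sum_wt_image_le _ _
      _ ≤ ∑ x ∈ F r, 2 * x.wt := Finset.sum_le_sum fun x hx => trunc_wt_le (hp x hx)
      _ < 4 := by
        rw [← Finset.mul_sum]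
        linarith [hw r]
  -- Any finite part of `G` sits inside a single truncated cover.
  have hsumG : ∀ T : Finset Item, (∀ y ∈ T, y ∈ G) → ∑ y ∈ T, y.wt ≤ 4 := by
    intro T hT
    obtain ⟨r, hr⟩ := ((Filter.eventually_all_finset T).2 hT).exists
    exact (Finset.sum_le_sum_of_subset_of_nonneg hr fun y _ _ => y.wt_pos.le).trans (hsumF r).le
  have hsummable : Summable (G.indicator Item.wt) := by
    refine summable_of_sum_le (c := 4)
      (fun y => Set.indicator_nonneg (fun y _ => y.wt_pos.le) y) fun T => ?_
    have : ∑ y ∈ T, G.indicator Item.wt y = ∑ y ∈ T.filter (· ∈ G), y.wt := by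
      rw [Finset.sum_filter]
      rfl
    rw [this]
    exact hsumG _ fun y hy => (Finset.mem_filter.1 hy).2
  -- All but a finite part of `G` has weight below `ε`; the set `C` is the complement of that finite
  -- part.
  obtain ⟨G₀, hG₀⟩ := summable_iff_vanishing_norm.1 hsummable ε hε
  set G₁ := G₀.filter (· ∈ G) with hG₁
  have hG₁G : ∀ y ∈ G₁, y ∈ G := fun y hy => (Finset.mem_filter.1 hy).2
  have hvanish : ∀ T : Finset Item, (∀ y ∈ T, y ∈ G) → Disjoint T G₁ → ∑ y ∈ T, y.wt < ε := by
    intro T hT hdisj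
    have h1 : Disjoint T G₀ := by
      refine Finset.disjoint_left.2 fun y hy hy0 => ?_
      exact Finset.disjoint_left.1 hdisj hy (Finset.mem_filter.2 ⟨hy0, hT y hy⟩)
    have h2 := hG₀ T h1
    have h3 : ∑ y ∈ T, G.indicator Item.wt y = ∑ y ∈ T, y.wt :=
      Finset.sum_congr rfl fun y hy => Set.indicator_of_mem (hT y hy) _
    rw [h3] at h2
    exact (le_abs_self _).trans_lt h2
  have hGlim : ∀ y ∈ G, y ∈ limStage k := by
    intro y hy
    obtain ⟨r, x, hx, rfl⟩ := hGF y hy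
    exact trunc_mem_limStage (hF r x hx).1
  have hGinv : ∀ y ∈ G, Inv m y.set := by
    intro y hy
    obtain ⟨r, x, hx, rfl⟩ := hGF y hy
    exact inv_trunc (hF r x hx).2
  have hGdep : ∀ y ∈ G, ∃ n, Dep n y.set := by
    intro y hy
    obtain ⟨r, x, hx, rfl⟩ := hGF y hy
    exact ⟨cut x, dep_trunc x⟩
  choose! d hd using hGdep
  refine ⟨(⋃ y ∈ G₁, y.set)ᶜ, ⟨G₁.sup d, ?_⟩, ?_, ?_, fun i => ?_⟩
  · exact (Dep.iUnion fun y => Dep.iUnion fun hy =>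
      (hd y (hG₁G y hy)).mono (Finset.le_sup (f := d) hy)).compl
  · exact (Inv.iUnion fun y => Inv.iUnion fun hy => hGinv y (hG₁G y hy)).compl
  · filter_upwards [eventually_subset_stage fun y hy => hGlim y (hG₁G y hy)] with p hp hsmall
    have h1 : Small (stage p k) (⋃ y ∈ G₁, y.set) 5 :=
      ⟨G₁, fun y hy => hp y hy, fun u hu => by simpa using hu,
        (hsumG G₁ hG₁G).trans_lt (by norm_num)⟩
    -- Were `C` small, weight below `1 + 5` would cover the whole space.
    refine not_small_univ p k ((hsmall.union h1).mono le_rfl ?_ ?_)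
    · rw [Set.compl_union_self]
    · have := eight_le_bound k
      linarith
  · obtain ⟨n, hn⟩ := hdep i
    -- There are finitely many items local to `n`, so some `r > i` has all its local truncated items
    -- in `G`.
    have hev : ∀ᶠ r in lim, ∀ y ∈ localItems n, (y ∈ (F r).image trunc → y ∈ G) := by
      rw [Filter.eventually_all_finite (finite_localItems n)]
      intro y _
      by_cases hy : y ∈ G
      · exact Eventually.of_forall fun _ _ => hy
      · exact (Ultrafilter.eventually_not.2 hy).mono fun r hr h => absurd h hr
    have hgt : ∀ᶠ r in lim, i < r :=
      (Nat.hyperfilter_le_atTop) (eventually_gt_atTop i)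
    obtain ⟨r, hr, hir⟩ := (hev.and hgt).exists
    obtain ⟨p, hp⟩ := hstage r
    have hTG : ∀ x ∈ (F r).filter (fun x => cut x ≤ n), trunc x ∈ G := by
      intro x hx
      obtain ⟨hxF, hxn⟩ := Finset.mem_filter.1 hx
      have hxI := Finset.mem_image_of_mem trunc hxF
      refine hr _ (mem_localItems (trunc_mem (hp x hxF)) ?_ ((dep_trunc x).mono hxn) ?_) hxI
      · exact (wt_lt_of_sum_lt hxI (hsumF r)).trans (by norm_num)
      · intro j hj
        exact (Finset.mem_filter.1 hj).2.2.trans_le hxn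
    set T := (((F r).filter fun x => cut x ≤ n).image trunc) \ G₁ with hT
    have hTG' : ∀ y ∈ T, y ∈ G := by
      intro y hy
      obtain ⟨x, hx, rfl⟩ := Finset.mem_image.1 (Finset.mem_sdiff.1 hy).1
      exact hTG x hx
    refine ⟨T, fun y hy => hGlim y (hTG' y hy), ?_, hvanish T hTG' Finset.sdiff_disjoint⟩
    rintro y ⟨hyY, hyC⟩
    suffices h : ∃ x ∈ F r, cut x ≤ n ∧ y ∈ (trunc x).set by
      obtain ⟨x, hx, hxn, hxy⟩ := h
      refine ⟨trunc x, Finset.mem_sdiff.2 ⟨Finset.mem_image_of_mem _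
        (Finset.mem_filter.2 ⟨hx, hxn⟩), fun h1 => hyC ?_⟩, hxy⟩
      exact Set.mem_biUnion h1 hxy
    by_contra! hc
    -- Items with cut beyond `n` have half of their indices above `n`, so changing `y` there evades
    -- them without leaving `Y i`.
    obtain ⟨y', hy'⟩ := exists_avoiding (k := k) (le_max_left n (idxBound (F r)))
      (F := (F r).filter fun x => n < cut x) (fun x hx => hp x (Finset.mem_filter.1 hx).1)
      ((sum_wt_filter_le _ _).trans_lt ((hw r).trans (by norm_num)))
      (fun x hx => (card_le_of_lt_cut (Finset.mem_filter.1 hx).1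
        (Finset.mem_filter.1 hx).2).trans (two_mul_le_shrink 0 _)) y
    have hu := agree_splice n y y'
    set u := splice n y y'
    obtain ⟨x, hx, hxu⟩ := hcov r u
      (Set.mem_biUnion (x := i) (Finset.mem_coe.2 (Finset.mem_range.2 hir)) (hn _ _ hu hyY))
    rcases le_or_gt (cut x) n with h | h
    · exact hc x hx h (dep_trunc x u y (hu.symm.mono h) (subset_trunc x hxu))
    · exact hy' u (agree_refl _ _) x (Finset.mem_filter.2 ⟨hx, h⟩) hxu

/-- If some finite union of the `Y i` is large for almost all `p`, it can serve as `C`: later `Y i`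
are disjoint from it. -/
lemma exists_large_set {k m : ℕ} {Y : ℕ → Set Seq} (hdep : ∀ i, ∃ n, Dep n (Y i))
    (hinv : ∀ i, Inv m (Y i)) (hdisj : Pairwise (Function.onFun Disjoint Y)) {ε : ℝ}
    (hε : 0 < ε) :
    ∃ C : Set Seq, (∃ n, Dep n C) ∧ Inv m C ∧ (∀ᶠ p in lim, ¬ Small (stage p k) C 1) ∧
      ∀ᶠ i in atTop, Small (limStage k) (Y i ∩ C) ε := by
  by_cases h : ∀ r, ∀ᶠ p in lim, Small (stage p k) (⋃ i ∈ Finset.range r, Y i) 1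
  · obtain ⟨C, h1, h2, h3, h4⟩ := exists_large_of_unions_small hdep hinv h hε
    exact ⟨C, h1, h2, h3, Eventually.of_forall h4⟩
  · push Not at h
    obtain ⟨r, hr⟩ := h
    choose d hd using hdep
    refine ⟨⋃ i ∈ Finset.range r, Y i, ⟨(Finset.range r).sup d, ?_⟩,
      Inv.iUnion fun i => Inv.iUnion fun _ => hinv i, hr, ?_⟩
    · exact Dep.iUnion fun i => Dep.iUnion fun hi => (hd i).mono (Finset.le_sup (f := d) hi)
    · filter_upwards [eventually_ge_atTop r] with i hi
      have : Y i ∩ ⋃ j ∈ Finset.range r, Y j = ∅ := by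
        rw [Set.eq_empty_iff_forall_notMem]
        rintro y ⟨hy, hy'⟩
        simp only [Set.mem_iUnion, Finset.mem_range] at hy'
        obtain ⟨j, hj, hyj⟩ := hy'
        exact Set.disjoint_left.1 (hdisj (by omega : i ≠ j)) hy hyj
      rw [this]
      exact small_empty _ hε

/-- Over each of the finitely many atoms at `m`, `exists_large_set` provides a large set `C z`, and
`H` glues these together. The trace of `E i \ H` from an atom misses its `C z`, which is not small.
-/
lemma exists_thin_step (k m : ℕ) {E : ℕ → Set Seq} (hdep : ∀ i, ∃ n, Dep n (E i))
    (hdisj : Pairwise (Function.onFun Disjoint E)) {ε : ℝ} (hε : 0 < ε) :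
    ∃ n > m, ∃ H : Set Seq, ∀ᶠ i in atTop, Small (limStage k) (E i ∩ H) ε ∧
      ∀ᶠ p in lim, ThinAt (stage p k) (E i \ H) m n := by
  classical
  have hfin : (Set.range fun w : (∀ i : Fin m, Fin (i + 1)) =>
      (fun i => if h : i < m then w ⟨i, h⟩ else 0 : Seq)).Finite := Set.finite_range _
  set Z := hfin.toFinset with hZ
  have hZmem : ∀ z : Seq, ∃ z' ∈ Z, Agree m z z' := by
    intro z
    refine ⟨fun i => if h : i < m then z i else 0, ?_, fun i hi => by simp [hi]⟩
    rw [hZ, Set.Finite.mem_toFinset]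
    exact ⟨fun i => z i, rfl⟩
  -- One half of `ε` pays for all the atoms, the other for the strict inequality in `Small.biUnion`.
  set δ := ε / (2 * (Z.card + 1)) with hδ
  have hZpos : (0 : ℝ) < Z.card + 1 := by positivity
  have hδpos : 0 < δ := by positivity
  have hC : ∀ z : Seq, ∃ C : Set Seq, (∃ n, Dep n C) ∧ Inv m C ∧
      (∀ᶠ p in lim, ¬ Small (stage p k) C 1) ∧
      ∀ᶠ i in atTop, Small (limStage k) (splice m z ⁻¹' E i ∩ C) δ := by
    intro z
    refine exists_large_set (fun i => ?_) (fun i => inv_splice_preimage m z _) ?_ hδpos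
    · obtain ⟨n, hn⟩ := hdep i
      exact ⟨n, hn.splice_preimage m z⟩
    · exact fun i j hij => Disjoint.preimage _ (hdisj hij)
  choose C hCdep hCinv hClarge hCsmall using hC
  choose d hd using hCdep
  refine ⟨max (m + 1) (Z.sup d), lt_of_lt_of_le (Nat.lt_succ_self m) (le_max_left _ _),
    ⋃ z ∈ Z, {x | Agree m z x} ∩ C z, ?_⟩
  have hev := (Filter.eventually_all_finset Z).2 fun z _ => hCsmall z
  have hevp := (Filter.eventually_all_finset Z).2 fun z _ => hClarge z
  filter_upwards [hev] with i hi
  refine ⟨?_, ?_⟩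
  · refine (Small.biUnion Z hi (half_pos hε)).mono le_rfl ?_ ?_
    · rintro x ⟨hxE, hx⟩
      simp only [Set.mem_iUnion] at hx ⊢
      obtain ⟨z, hz, hzx, hxC⟩ := hx
      refine ⟨z, hz, ?_, hxC⟩
      rw [Set.mem_preimage, splice_eq_of_agree hzx]
      exact hxE
    · have : (Z.card : ℝ) * δ ≤ ε / 2 := by
        rw [hδ, mul_div_assoc', div_le_div_iff₀ (by positivity) (by norm_num)]
        nlinarith
      linarith
  · filter_upwards [hevp] with p hp z hz
    obtain ⟨z', hz', hzz'⟩ := hZmem z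
    refine hp z' hz' (hz.mono le_rfl ?_ le_rfl)
    rintro y hy ⟨y', ⟨hy'E, hy'H⟩, hagree⟩
    refine hy'H (Set.mem_biUnion (Finset.mem_coe.2 hz') ⟨?_, ?_⟩)
    · exact hzz'.symm.trans (agree_splice m z y')
    · refine (hCinv z' z y').2 (hd z' y y' (hagree.symm.mono ?_) hy)
      exact (Finset.le_sup (f := d) hz').trans (le_max_right _ _)

/-- A new index is only made thin against the largest old one; gaps from smaller indices inherit
thinness because they contain an older thin gap. -/
lemma exists_thin_chain (k : ℕ) {E : ℕ → Set Seq} (hdep : ∀ i, ∃ n, Dep n (E i))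
    (hdisj : Pairwise (Function.onFun Disjoint E)) {ε : ℝ} (hε : 0 < ε) (N : ℕ) :
    ∃ (I : Finset ℕ) (b : ℕ) (H : Set Seq), I.card = N + 1 ∧ b ∈ I ∧ (∀ i ∈ I, i ≤ b) ∧
      ∀ᶠ i in atTop, Small (limStage k) (E i ∩ H) (N * ε + ε) ∧
        ∀ᶠ p in lim, ∀ m ∈ I, ∀ n ∈ I, m < n → ThinAt (stage p k) (E i \ H) m n := by
  classical
  induction N with
  | zero =>
    refine ⟨{0}, 0, ∅, by simp, by simp, by simp, Eventually.of_forall fun i => ⟨?_, ?_⟩⟩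
    · simpa using small_empty _ hε
    · refine Eventually.of_forall fun p m hm n hn hmn => ?_
      rw [Finset.mem_singleton] at hm hn
      omega
  | succ N ih =>
    obtain ⟨I, b, H, hcard, hb, hIb, hev⟩ := ih
    obtain ⟨n, hn, H', hev'⟩ := exists_thin_step k b hdep hdisj hε
    have hnI : n ∉ I := fun h => absurd (hIb n h) (by omega)
    refine ⟨insert n I, n, H ∪ H', by rw [Finset.card_insert_of_notMem hnI, hcard],
      Finset.mem_insert_self _ _, ?_, ?_⟩
    · intro i hi
      rcases Finset.mem_insert.1 hi with rfl | hi
      · exact le_rfl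
      · exact (hIb i hi).trans hn.le
    · filter_upwards [hev, hev'] with i h1 h2
      refine ⟨?_, ?_⟩
      · rw [Set.inter_union_distrib_left]
        refine (h1.1.union h2.1).mono le_rfl le_rfl (le_of_eq ?_)
        push_cast
        ring
      · filter_upwards [h1.2, h2.2] with p h3 h4 m hm₀ n' hn₀ hmn'
        have hsub1 : E i \ (H ∪ H') ⊆ E i \ H := Set.sdiff_subset_sdiff_right Set.subset_union_left
        have hsub2 : E i \ (H ∪ H') ⊆ E i \ H' := Set.sdiff_subset_sdiff_right Set.subset_union_right
        rcases Finset.mem_insert.1 hm₀ with rfl | hm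
        · rcases Finset.mem_insert.1 hn₀ with rfl | hn'
          · omega
          · have := hIb n' hn'
            omega
        · rcases Finset.mem_insert.1 hn₀ with rfl | hn'
          · rcases (hIb m hm).lt_or_eq with h | rfl
            · exact (h3 m hm b hb h).mono hsub1 hn.le
            · exact h4.mono hsub2 le_rfl
          · exact (h3 m hm n' hn' hmn').mono hsub1 le_rfl

/-- The limit submeasure is exhaustive. -/
theorem eventually_small {E : ℕ → Set Seq} (hdep : ∀ i, ∃ n, Dep n (E i))
    (hdisj : Pairwise (Function.onFun Disjoint E)) {ε : ℝ} (hε : 0 < ε) :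
    ∀ᶠ i in atTop, Small (limStage 0) (E i) ε := by
  obtain ⟨k, hk⟩ := exists_pow_lt_of_lt_one (half_pos hε) (by norm_num : (1 / 2 : ℝ) < 1)
  -- With exactly `maxCard k` indices the item `E i \ H` weighs just `2 ^ (-k)`. Thinness is taken
  -- against level `k + 1`, as membership at level `k` demands.
  obtain ⟨N, hN⟩ : ∃ N, maxCard k = N + 1 := ⟨maxCard k - 1, by have := maxCard_pos k; omega⟩
  obtain ⟨I, b, H, hcard, hb, -, hev⟩ := exists_thin_chain (k + 1) hdep hdisj
    (ε := ε / (2 * (N + 1))) (by positivity) N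
  filter_upwards [hev] with i hi
  have h1 : Small (limStage 0) (E i \ H) (ε / 2) := by
    refine ⟨{⟨k, E i \ H, I⟩}, ?_, fun y hy => ⟨_, Finset.mem_singleton_self _, hy⟩, ?_⟩
    · rw [Finset.coe_singleton, Set.singleton_subset_iff]
      have hge : ∀ᶠ p in lim, k ≤ p := Nat.hyperfilter_le_atTop (eventually_ge_atTop k)
      filter_upwards [hi.2, hge] with p hp hkp
      exact ⟨Nat.zero_le _, mem_iff.2 ⟨hkp, ⟨b, hb⟩, by rw [hcard, hN], hp⟩⟩
    · rw [Finset.sum_singleton, Item.wt]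
      simp only [hcard, ← hN, wgt_maxCard]
      exact hk
  refine (h1.union (hi.1.mono (limStage_anti (Nat.zero_le _)) le_rfl le_rfl)).mono le_rfl ?_ ?_
  · rw [Set.sdiff_union_inter]
  · have : N * (ε / (2 * (N + 1))) + ε / (2 * (N + 1)) = ε / 2 := by
      field_simp
    rw [this, add_halves]

lemma not_small_limStage (n : ℕ) (τ : Fin (n + 1)) :
    ¬ Small (limStage 0) {z | z n = τ} 1 := fun h => by
  obtain ⟨p, hp⟩ := h.eventually.exists
  exact not_small_coordinate p 0 n τ hp

open MeasureTheory
open scoped ENNReal symmDiff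

/-! ### Exhaustive outer measures -/

section Exhaustive

variable {Ω : Type*}

/-- The outer measure tends to zero along all disjoint sequences in `𝒜`. -/
def ExhaustiveOn (μ : OuterMeasure Ω) (𝒜 : Set (Set Ω)) : Prop :=
  ∀ E : ℕ → Set Ω, (∀ i, E i ∈ 𝒜) → Pairwise (Function.onFun Disjoint E) →
    Tendsto (fun i => μ (E i)) atTop (𝓝 0)

/-- The sets that can be approximated by members of `𝒜`. -/
def approximable (μ : OuterMeasure Ω) (𝒜 : Set (Set Ω)) : Set (Set Ω) :=
  {E | ∀ ε : ℝ≥0∞, 0 < ε → ∃ B ∈ 𝒜, μ (E ∆ B) ≤ ε}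

variable {μ : OuterMeasure Ω} {𝒜 : Set (Set Ω)}

/-- Otherwise iteration produces disjoint differences of measure above `ε`. -/
lemma ExhaustiveOn.exists_diff_le (h : ExhaustiveOn μ 𝒜) (h𝒜 : IsSetAlgebra 𝒜) {E : ℕ → Set Ω}
    (hE : ∀ i, E i ∈ 𝒜) (hmono : Monotone E) {ε : ℝ≥0∞} (hε : 0 < ε) :
    ∃ N, ∀ m ≥ N, μ (E m \ E N) ≤ ε := by
  by_contra! hc
  choose f hf1 hf2 using hc
  let n : ℕ → ℕ := fun j => f^[j] 0
  have hn : ∀ j, n (j + 1) = f (n j) := fun j => Function.iterate_succ_apply' f j 0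
  have hnmono : Monotone n := monotone_nat_of_le_succ fun j => by rw [hn]; exact hf1 _
  have hdisj : Pairwise (Function.onFun Disjoint fun j => E (n (j + 1)) \ E (n j)) := by
    refine (pairwise_disjoint_on _).2 fun i j hij => Set.disjoint_left.2 fun x hx hx' => ?_
    exact hx'.2 (hmono (hnmono (Nat.succ_le_of_lt hij)) hx.1)
  have ht := h _ (fun j => h𝒜.sdiff_mem (hE _) (hE _)) hdisj
  obtain ⟨j, hj⟩ := (ht.eventually (gt_mem_nhds hε)).exists
  have := hf2 (n j)
  rw [← hn] at this
  exact absurd hj this.le.not_gt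

lemma ExhaustiveOn.exists_iUnion_diff_le (h : ExhaustiveOn μ 𝒜) (h𝒜 : IsSetAlgebra 𝒜)
    {E : ℕ → Set Ω} (hE : ∀ i, E i ∈ 𝒜) (hmono : Monotone E) {ε : ℝ≥0∞} (hε : 0 < ε) :
    ∃ N, μ ((⋃ i, E i) \ E N) ≤ ε := by
  obtain ⟨δ, hδ, hsum⟩ := ENNReal.exists_pos_sum_of_countable' hε.ne' ℕ
  have hev : ∀ j, ∀ᶠ N in atTop, ∀ m ≥ N, μ (E m \ E N) ≤ δ j := by
    intro j
    obtain ⟨N, hN⟩ := h.exists_diff_le h𝒜 hE hmono (hδ j)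
    filter_upwards [eventually_ge_atTop N] with N' hN' m hm
    exact (measure_mono (Set.sdiff_subset_sdiff_right (hmono hN'))).trans (hN m (hN'.trans hm))
  obtain ⟨φ, hφ, hφδ⟩ := extraction_forall_of_eventually' fun j =>
    (eventually_atTop.1 (hev j))
  refine ⟨φ 0, ?_⟩
  have hsub : (⋃ i, E i) \ E (φ 0) ⊆ ⋃ j, E (φ (j + 1)) \ E (φ j) := by
    rintro x ⟨hx, hx0⟩
    obtain ⟨m, hm⟩ := Set.mem_iUnion.1 hx
    have hex : ∃ j, x ∈ E (φ j) := ⟨m, hmono hφ.le_apply hm⟩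
    classical
    have hpos : Nat.find hex ≠ 0 := fun h0 => hx0 (h0 ▸ Nat.find_spec hex)
    obtain ⟨j, hj⟩ := Nat.exists_eq_succ_of_ne_zero hpos
    refine Set.mem_iUnion.2 ⟨j, ?_, ?_⟩
    · have := Nat.find_spec hex
      rwa [hj] at this
    · exact Nat.find_min hex (by omega)
  calc μ ((⋃ i, E i) \ E (φ 0)) ≤ μ (⋃ j, E (φ (j + 1)) \ E (φ j)) := measure_mono hsub
    _ ≤ ∑' j, μ (E (φ (j + 1)) \ E (φ j)) := measure_iUnion_le _
    _ ≤ ∑' j, δ j := ENNReal.tsum_le_tsum fun j => hφδ j _ (hφ.monotone (Nat.le_succ j))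
    _ ≤ ε := hsum.le

lemma subset_approximable : 𝒜 ⊆ approximable μ 𝒜 := fun E hE ε _ => ⟨E, hE, by simp⟩

lemma isSetAlgebra_approximable (h𝒜 : IsSetAlgebra 𝒜) : IsSetAlgebra (approximable μ 𝒜) where
  empty_mem := subset_approximable h𝒜.empty_mem
  compl_mem := by
    intro E hE ε hε
    obtain ⟨B, hB, h⟩ := hE ε hε
    refine ⟨Bᶜ, h𝒜.compl_mem hB, ?_⟩
    rwa [compl_symmDiff_compl]
  union_mem := by
    intro E F hE hF ε hε
    obtain ⟨B, hB, h⟩ := hE (ε / 2) (ENNReal.half_pos hε.ne')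
    obtain ⟨C, hC, h'⟩ := hF (ε / 2) (ENNReal.half_pos hε.ne')
    refine ⟨B ∪ C, h𝒜.union_mem hB hC, ?_⟩
    have hsub : (E ∪ F) ∆ (B ∪ C) ⊆ E ∆ B ∪ F ∆ C := by
      intro x
      simp only [Set.mem_symmDiff, Set.mem_union]
      tauto
    calc μ ((E ∪ F) ∆ (B ∪ C)) ≤ μ (E ∆ B ∪ F ∆ C) := measure_mono hsub
      _ ≤ μ (E ∆ B) + μ (F ∆ C) := measure_union_le _ _
      _ ≤ ε / 2 + ε / 2 := add_le_add h h'
      _ = ε := ENNReal.add_halves ε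

lemma ExhaustiveOn.approximable (h : ExhaustiveOn μ 𝒜) (h𝒜 : IsSetAlgebra 𝒜) :
    ExhaustiveOn μ (approximable μ 𝒜) := by
  intro E hE hdisj
  rw [ENNReal.tendsto_atTop_zero]
  intro ε hε
  obtain ⟨δ, hδ, hsum⟩ := ENNReal.exists_pos_sum_of_countable' (ENNReal.half_pos hε.ne').ne' ℕ
  choose B hB hEB using fun i => hE i (δ i) (hδ i)
  have hD : ∀ i, disjointed B i ∈ 𝒜 := fun i =>
    disjointedRec (p := (· ∈ 𝒜)) (fun {_ j} ht => h𝒜.sdiff_mem ht (hB j)) (hB i)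
  obtain ⟨N, hN⟩ := (ENNReal.tendsto_atTop_zero.1 (h _ hD (disjoint_disjointed B))) (ε / 2)
    (ENNReal.half_pos hε.ne')
  refine ⟨N, fun n hn => ?_⟩
  -- A point of `E n` in an earlier `B j` is not in `E j`, hence is an approximation error.
  have hsub : E n ⊆ disjointed B n ∪ ⋃ i, E i ∆ B i := by
    intro x hx
    by_cases hxB : x ∈ B n
    · by_cases hex : ∃ j < n, x ∈ B j
      · obtain ⟨j, hj, hxj⟩ := hex
        refine Or.inr (Set.mem_iUnion.2 ⟨j, Set.mem_symmDiff.2 (Or.inr ⟨hxj, fun hxE => ?_⟩)⟩)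
        exact Set.disjoint_left.1 (hdisj hj.ne) hxE hx
      · push Not at hex
        left
        rw [disjointed_eq_inter_compl]
        exact ⟨hxB, Set.mem_iInter₂.2 hex⟩
    · exact Or.inr (Set.mem_iUnion.2 ⟨n, Set.mem_symmDiff.2 (Or.inl ⟨hx, hxB⟩)⟩)
  calc μ (E n) ≤ μ (disjointed B n ∪ ⋃ i, E i ∆ B i) := measure_mono hsub
    _ ≤ μ (disjointed B n) + μ (⋃ i, E i ∆ B i) := measure_union_le _ _
    _ ≤ ε / 2 + ε / 2 := add_le_add (hN n hn) ((measure_iUnion_le _).trans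
        ((ENNReal.tsum_le_tsum hEB).trans hsum.le))
    _ = ε := ENNReal.add_halves ε

lemma iUnion_mem_approximable (h : ExhaustiveOn μ 𝒜) (h𝒜 : IsSetAlgebra 𝒜) {E : ℕ → Set Ω}
    (hE : ∀ i, E i ∈ approximable μ 𝒜) : ⋃ i, E i ∈ approximable μ 𝒜 := by
  intro ε hε
  have halg := isSetAlgebra_approximable (μ := μ) h𝒜
  have hacc : ∀ n, Set.accumulate E n ∈ approximable μ 𝒜 := by
    intro n
    induction n with
    | zero => simpa [Set.accumulate_def] using hE 0
    | succ n ih =>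
      rw [Set.accumulate_succ]
      exact halg.union_mem ih (hE _)
  obtain ⟨N, hN⟩ := (h.approximable h𝒜).exists_iUnion_diff_le halg hacc Set.monotone_accumulate
    (ENNReal.half_pos hε.ne')
  obtain ⟨B, hB, hNB⟩ := hacc N (ε / 2) (ENNReal.half_pos hε.ne')
  refine ⟨B, hB, ?_⟩
  rw [Set.iUnion_accumulate] at hN
  have hle : Set.accumulate E N ⊆ ⋃ i, E i := Set.accumulate_subset_iUnion N
  have hsub : (⋃ i, E i) ∆ B ⊆ ((⋃ i, E i) \ Set.accumulate E N) ∪ Set.accumulate E N ∆ B := by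
    intro x
    have := @hle x
    simp only [Set.mem_symmDiff, Set.mem_union, Set.mem_sdiff]
    tauto
  calc μ ((⋃ i, E i) ∆ B) ≤ _ := measure_mono hsub
    _ ≤ _ := measure_union_le _ _
    _ ≤ ε / 2 + ε / 2 := add_le_add hN hNB
    _ = ε := ENNReal.add_halves ε

/-- The σ-algebra of the sets approximable by members of `𝒜`. -/
abbrev approximableSpace (h : ExhaustiveOn μ 𝒜) (h𝒜 : IsSetAlgebra 𝒜) : MeasurableSpace Ω where
  MeasurableSet' E := E ∈ approximable μ 𝒜
  measurableSet_empty := (isSetAlgebra_approximable h𝒜).empty_mem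
  measurableSet_compl _ hE := (isSetAlgebra_approximable (μ := μ) h𝒜).compl_mem hE
  measurableSet_iUnion _ := iUnion_mem_approximable h h𝒜

end Exhaustive

/-! ### The outer measure on sequences -/

/-- The limit submeasure of a set of sequences. -/
noncomputable def limSub (B : Set Seq) : ℝ≥0∞ :=
  ⨅ r : {r : ℝ // Small (limStage 0) B r}, ENNReal.ofReal r

lemma limSub_le {B : Set Seq} {r : ℝ} (h : Small (limStage 0) B r) : limSub B ≤ ENNReal.ofReal r :=
  iInf_le (fun r : {r : ℝ // Small (limStage 0) B r} => ENNReal.ofReal r) ⟨r, h⟩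

lemma limSub_empty : limSub ∅ = 0 := by
  refine le_antisymm (ENNReal.le_of_forall_pos_le_add fun ε hε _ => ?_) zero_le
  have := limSub_le (small_empty (limStage 0) (NNReal.coe_pos.2 hε))
  simpa using this

lemma limSub_union_le (A B : Set Seq) : limSub (A ∪ B) ≤ limSub A + limSub B := by
  unfold limSub
  rw [ENNReal.iInf_add]
  refine le_iInf fun r => ?_
  rw [ENNReal.add_iInf]
  exact le_iInf fun t => (limSub_le (r.2.union t.2)).trans ENNReal.ofReal_add_le

lemma limSub_biUnion_le {ι : Type*} (s : Finset ι) (t : ι → Set Seq) :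
    limSub (⋃ i ∈ s, t i) ≤ ∑ i ∈ s, limSub (t i) := by
  classical
  induction s using Finset.induction_on with
  | empty => simp [limSub_empty]
  | insert a s ha ih =>
    rw [Finset.set_biUnion_insert, Finset.sum_insert ha]
    exact (limSub_union_le _ _).trans (add_le_add le_rfl ih)

lemma one_le_limSub {B : Set Seq} {n : ℕ} {τ : Fin (n + 1)} (h : {z : Seq | z n = τ} ⊆ B) :
    1 ≤ limSub B := by
  refine le_iInf fun r => ?_
  by_contra! hc
  refine not_small_limStage n τ (r.2.mono le_rfl h ?_)
  exact (ENNReal.ofReal_lt_one.1 hc).le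

lemma isOpen_of_dep {n : ℕ} {X : Set Seq} (hX : Dep n X) : IsOpen X := by
  let π : Seq → ∀ i : Fin n, Fin (i + 1) := fun z i => z i
  have hπ : Continuous π := continuous_pi fun i => continuous_apply (i : ℕ)
  have : X = π ⁻¹' (π '' X) := by
    refine Set.Subset.antisymm (Set.subset_preimage_image _ _) ?_
    rintro y ⟨x, hx, hxy⟩
    exact hX x y (fun i hi => congrFun hxy ⟨i, hi⟩) hx
  rw [this]
  exact (isOpen_discrete _).preimage hπ

/-- The sets determined by finitely many coordinates. -/
def cylinders : Set (Set Seq) := {X | ∃ n, Dep n X}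

lemma isSetAlgebra_cylinders : IsSetAlgebra cylinders where
  empty_mem := ⟨0, fun _ _ _ h => h⟩
  compl_mem := fun _ ⟨n, hn⟩ => ⟨n, hn.compl⟩
  union_mem := fun _ _ ⟨m, hm⟩ ⟨n, hn⟩ =>
    ⟨max m n, (hm.mono (le_max_left _ _)).union (hn.mono (le_max_right _ _))⟩

lemma coordinate_mem_cylinders (n : ℕ) (τ : Fin (n + 1)) : {z : Seq | z n = τ} ∈ cylinders :=
  ⟨n + 1, fun x y hxy (hx : x n = τ) => by
    rw [Set.mem_ofPred_eq, ← hxy n (Nat.lt_succ_self n), hx]⟩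

lemma iInf_limSub_empty : ⨅ _ : (∅ : Set Seq) ∈ cylinders, limSub ∅ = 0 := by
  simp [isSetAlgebra_cylinders.empty_mem, limSub_empty]

/-- The outer measure obtained from the limit submeasure of the cylinders. -/
noncomputable def seqOuter : OuterMeasure Seq :=
  OuterMeasure.ofFunction (fun B => ⨅ _ : B ∈ cylinders, limSub B) iInf_limSub_empty

lemma exhaustiveOn_seqOuter : ExhaustiveOn seqOuter cylinders := by
  intro E hE hdisj
  rw [ENNReal.tendsto_atTop_zero]
  intro ε hε
  obtain ⟨r, hr0, hrε⟩ := ENNReal.lt_iff_exists_nnreal_btwn.1 hε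
  have hr : 0 < (r : ℝ) := by exact_mod_cast hr0
  obtain ⟨N, hN⟩ := eventually_atTop.1 (eventually_small hE hdisj hr)
  refine ⟨N, fun n hn => ?_⟩
  calc seqOuter (E n) ≤ ⨅ _ : E n ∈ cylinders, limSub (E n) := OuterMeasure.ofFunction_le _
    _ ≤ limSub (E n) := iInf_le _ (hE n)
    _ ≤ ENNReal.ofReal r := limSub_le (hN n hn)
    _ = r := ENNReal.ofReal_coe_nnreal
    _ ≤ ε := hrε.le

lemma one_le_seqOuter (n : ℕ) (τ : Fin (n + 1)) : 1 ≤ seqOuter {z | z n = τ} := by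
  unfold seqOuter
  rw [OuterMeasure.ofFunction_apply]
  refine le_iInf fun t => le_iInf fun ht => ?_
  by_contra! hc
  -- A non-cylinder costs `⊤`. For covers by cylinders, compactness then reduces to finite covers.
  have hcyl : ∀ i, t i ∈ cylinders := by
    intro i
    by_contra h
    have h1 := (ENNReal.le_tsum (f := fun i => ⨅ _ : t i ∈ cylinders, limSub (t i)) i).trans_lt hc
    simp [h] at h1
  have hopen : ∀ i, IsOpen (t i) := fun i => isOpen_of_dep (hcyl i).choose_spec
  have hcompact : IsCompact {z : Seq | z n = τ} := by
    obtain ⟨k, hk⟩ := isSetAlgebra_cylinders.compl_mem (coordinate_mem_cylinders n τ)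
    exact (isOpen_compl_iff.1 (isOpen_of_dep hk)).isCompact
  obtain ⟨s, hs⟩ := hcompact.elim_finite_subcover t hopen ht
  have h1 := (one_le_limSub hs).trans (limSub_biUnion_le s t)
  have h2 : ∑ i ∈ s, limSub (t i) ≤ ∑' i, ⨅ _ : t i ∈ cylinders, limSub (t i) := by
    refine le_trans (le_of_eq ?_) (ENNReal.sum_le_tsum s)
    exact Finset.sum_congr rfl fun i _ => by simp [hcyl i]
  exact absurd hc (h1.trans h2).not_gt

/-! ### Boolean algebras with a continuous submeasure -/

section BooleanAlgebra

variable {B : Type*} [BooleanAlgebra B]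

/-- A continuous submeasure, possibly with infinite values, that vanishes only at `⊥`. -/
structure IsMaharam (ν : B → ℝ≥0∞) : Prop where
  map_bot : ν ⊥ = 0
  mono : ∀ a b : B, a ≤ b → ν a ≤ ν b
  sup_le : ∀ a b : B, ν (a ⊔ b) ≤ ν a + ν b
  pos : ∀ a : B, ν a = 0 → a = ⊥
  tendsto : ∀ A : ℕ → B, Antitone A → IsGLB (Set.range A) ⊥ →
    Tendsto (fun n => ν (A n)) atTop (𝓝 0)

lemma IsSigmaComplete.exists_isLUB_range (hB : IsSigmaComplete B) {ι : Type*} [Countable ι]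
    (a : ι → B) : ∃ b, IsLUB (Set.range a) b := hB _ (Set.countable_range a)

lemma isGLB_sdiff_partialSups {a : ℕ → B} {s : B} (hs : IsLUB (Set.range a) s) :
    IsGLB (Set.range fun n => s \ partialSups a n) ⊥ := by
  refine ⟨fun _ _ => bot_le, fun c hc => ?_⟩
  have hc' : ∀ n, c ≤ s \ partialSups a n := fun n => hc ⟨n, rfl⟩
  have h1 : s ≤ cᶜ := hs.2 (by
    rintro _ ⟨n, rfl⟩
    refine (le_partialSups a n).trans ?_
    rw [le_compl_comm]
    exact (hc' n).trans (by rw [sdiff_eq]; exact inf_le_right))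
  have h2 : c ≤ s := (hc' 0).trans sdiff_le
  exact le_compl_self.1 (h2.trans h1) ▸ le_rfl

lemma IsMaharam.partialSups_le {ν : B → ℝ≥0∞} (hν : IsMaharam ν) (a : ℕ → B) (n : ℕ) :
    ν (partialSups a n) ≤ ∑ i ∈ Finset.range (n + 1), ν (a i) := by
  induction n with
  | zero => simp
  | succ n ih =>
    rw [partialSups_add_one, Finset.sum_range_succ]
    exact (hν.sup_le _ _).trans (add_le_add ih le_rfl)

/-- Continuity turns finite into countable subadditivity: the remainders of the supremum decrease to
`⊥`. -/
lemma IsMaharam.le_tsum {ν : B → ℝ≥0∞} (hν : IsMaharam ν) {a : ℕ → B} {s : B}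
    (hs : IsLUB (Set.range a) s) : ν s ≤ ∑' i, ν (a i) := by
  have ht := hν.tendsto (fun n => s \ partialSups a n)
    (fun m n hmn => sdiff_le_sdiff_left ((partialSups a).monotone hmn))
    (isGLB_sdiff_partialSups hs)
  have ht' := (tendsto_const_nhds (x := ∑' i, ν (a i))).add ht
  rw [add_zero] at ht'
  refine ge_of_tendsto' ht' fun n => ?_
  calc ν s ≤ ν (partialSups a n ⊔ s \ partialSups a n) :=
        hν.mono _ _ (by rw [sup_sdiff_self_right]; exact le_sup_right)
    _ ≤ ν (partialSups a n) + ν (s \ partialSups a n) := hν.sup_le _ _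
    _ ≤ _ := add_le_add ((hν.partialSups_le a n).trans (ENNReal.sum_le_tsum _)) le_rfl

/-- The least upper bounds of the tails of a sequence. -/
lemma IsSigmaComplete.exists_tails (hB : IsSigmaComplete B) (a : ℕ → B) :
    ∃ b : ℕ → B, Antitone b ∧ ∀ n, IsLUB (Set.range fun i => a (n + i)) (b n) := by
  choose b hb using fun n => hB.exists_isLUB_range fun i => a (n + i)
  refine ⟨b, fun m n hmn => (hb n).2 ?_, hb⟩
  rintro _ ⟨i, rfl⟩
  exact (hb m).1 ⟨n - m + i, by dsimp only; congr 1; omega⟩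

/-- The suprema of the tails decrease to `⊥`, since anything below all of them is disjoint from
every `a i`. -/
lemma IsMaharam.tendsto_of_disjoint (hB : IsSigmaComplete B) {ν : B → ℝ≥0∞} (hν : IsMaharam ν)
    {a : ℕ → B} (ha : ∀ i j, i ≠ j → a i ⊓ a j = ⊥) : Tendsto (fun n => ν (a n)) atTop (𝓝 0) := by
  obtain ⟨b, hb, hlub⟩ := hB.exists_tails a
  have hab : ∀ n, a n ≤ b n := fun n => (hlub n).1 ⟨0, rfl⟩
  have hglb : IsGLB (Set.range b) ⊥ := by
    refine ⟨fun _ _ => bot_le, fun c hc => ?_⟩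
    have h1 : ∀ i, a i ≤ cᶜ := by
      intro i
      have h2 : b (i + 1) ≤ (a i)ᶜ := (hlub (i + 1)).2 (by
        rintro _ ⟨j, rfl⟩
        exact le_compl_iff_disjoint_right.2 (disjoint_iff.2 (ha _ _ (by omega))))
      rw [le_compl_comm]
      exact (hc ⟨i + 1, rfl⟩).trans h2
    have h3 : b 0 ≤ cᶜ := (hlub 0).2 (by
      rintro _ ⟨j, rfl⟩
      exact h1 _)
    exact le_compl_self.1 ((hc ⟨0, rfl⟩).trans h3) ▸ le_rfl
  exact tendsto_of_tendsto_of_tendsto_of_le_of_le tendsto_const_nhds (hν.tendsto b hb hglb)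
    (fun _ => zero_le) fun n => hν.mono _ _ (hab n)

theorem IsMaharam.countableChainCondition (hB : IsSigmaComplete B) {ν : B → ℝ≥0∞}
    (hν : IsMaharam ν) : CountableChainCondition B := by
  intro C hC
  have hfin : ∀ n : ℕ, {c ∈ C | ((n : ℝ≥0∞) + 1)⁻¹ < ν c}.Finite := by
    intro n
    by_contra hinf
    let f := Set.Infinite.natEmbedding _ hinf
    have ht := hν.tendsto_of_disjoint hB (a := fun i => (f i : B)) fun i j hij =>
      hC _ (f i).2.1 _ (f j).2.1 fun h => hij (f.injective (Subtype.ext h))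
    have hpos : (0 : ℝ≥0∞) < ((n : ℝ≥0∞) + 1)⁻¹ := by
      rw [ENNReal.inv_pos]
      exact ENNReal.add_ne_top.2 ⟨ENNReal.natCast_ne_top n, ENNReal.one_ne_top⟩
    obtain ⟨i, hi⟩ := (ht.eventually (gt_mem_nhds hpos)).exists
    exact absurd hi (f i).2.2.le.not_gt
  refine ((Set.countable_iUnion fun n => (hfin n).countable).union
    (Set.countable_singleton (⊥ : B))).mono fun c hc => ?_
  by_cases h0 : ν c = 0
  · exact Or.inr (hν.pos c h0)
  · obtain ⟨n, hn⟩ := ENNReal.exists_inv_nat_lt h0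
    refine Or.inl (Set.mem_iUnion.2 ⟨n, hc, lt_of_le_of_lt ?_ hn⟩)
    exact ENNReal.inv_le_inv.2 le_self_add

lemma IsPartition.exists_exhaustion {P : Set B} (hP : IsPartition P) (hc : P.Countable) :
    ∃ c : ℕ → B, Monotone c ∧ IsLUB (Set.range c) ⊤ ∧ ∀ k, FinitelyCovered (c k) P := by
  classical
  obtain ⟨f, hf⟩ := (hc.insert ⊥).exists_eq_range (Set.insert_nonempty _ _)
  let F : ℕ → Finset B := fun k => ((Finset.range k).image f).filter (· ∈ P)
  refine ⟨fun k => (F k).sup id, fun m n hmn => Finset.sup_mono ?_, ⟨fun _ _ => le_top, ?_⟩,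
    fun k => ⟨F k, fun a ha => (Finset.mem_filter.1 (Finset.mem_coe.1 ha)).2, le_rfl⟩⟩
  · exact Finset.filter_subset_filter _
      (Finset.image_subset_image (Finset.range_subset_range.2 hmn))
  · intro u hu
    refine hP.2.2 fun a ha => ?_
    obtain ⟨j, rfl⟩ : a ∈ Set.range f := hf ▸ Set.mem_insert_of_mem _ ha
    refine le_trans ?_ (hu ⟨j + 1, rfl⟩)
    refine Finset.le_sup (f := id) (Finset.mem_filter.2 ⟨?_, ha⟩)
    exact Finset.mem_image_of_mem _ (Finset.self_mem_range_succ j)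

lemma FinitelyCovered.mono {a b : B} {P : Set B} (h : FinitelyCovered b P) (hab : a ≤ b) :
    FinitelyCovered a P := by
  obtain ⟨F, h1, h2⟩ := h
  exact ⟨F, h1, hab.trans h2⟩

theorem IsMaharam.weakSigmaInftyDistributive (hB : IsSigmaComplete B) {ν : B → ℝ≥0∞}
    (hν : IsMaharam ν) : WeakSigmaInftyDistributive B := by
  intro P hP
  have hccc := hν.countableChainCondition hB
  choose c hcmono hclub hccov using fun n => (hP n).exists_exhaustion (hccc _ (hP n).1)
  have hlim : ∀ n, Tendsto (fun k => ν (c n k)ᶜ) atTop (𝓝 0) := by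
    intro n
    refine hν.tendsto _ (fun i j hij => compl_le_compl (hcmono n hij))
      ⟨fun _ _ => bot_le, fun u hu => ?_⟩
    have h1 : (⊤ : B) ≤ uᶜ := (hclub n).2 (by
      rintro _ ⟨k, rfl⟩
      rw [le_compl_comm]
      exact hu ⟨k, rfl⟩)
    rw [le_bot_iff, ← compl_eq_top]
    exact top_le_iff.1 h1
  -- An Egorov argument: cutting each partition to a finite part at cost `δ n` leaves one element
  -- that is finitely covered for all `n` at once. Disjointifying these elements as `ε` tends to 0
  -- gives the partition.
  have hb : ∀ ε : ℝ≥0∞, 0 < ε → ∃ b : B, ν bᶜ ≤ ε ∧ ∀ n, FinitelyCovered b (P n) := by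
    intro ε hε
    obtain ⟨δ, hδ, hsum⟩ := ENNReal.exists_pos_sum_of_countable' hε.ne' ℕ
    choose k hk using fun n => ((hlim n).eventually (gt_mem_nhds (hδ n))).exists
    obtain ⟨s, hs⟩ := hB.exists_isLUB_range fun n => (c n (k n))ᶜ
    refine ⟨sᶜ, ?_, fun n => (hccov n (k n)).mono (compl_le_iff_compl_le.1 (hs.1 ⟨n, rfl⟩))⟩
    rw [compl_compl]
    exact (hν.le_tsum hs).trans ((ENNReal.tsum_le_tsum fun n => (hk n).le).trans hsum.le)
  choose b hb1 hb2 using fun j : ℕ => hb ((j : ℝ≥0∞) + 1)⁻¹ (by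
    rw [ENNReal.inv_pos]
    exact ENNReal.add_ne_top.2 ⟨ENNReal.natCast_ne_top j, ENNReal.one_ne_top⟩)
  refine ⟨Set.range (disjointed b), ⟨?_, fun _ _ => le_top, ?_⟩, ?_⟩
  · rintro _ ⟨i, rfl⟩ _ ⟨j, rfl⟩ hij
    exact disjoint_iff.1 (disjoint_disjointed b fun h => hij (by rw [h]))
  · intro u hu
    have h1 : ∀ j, b j ≤ u := by
      intro j
      refine (le_partialSups b j).trans ?_
      rw [← partialSups_disjointed]
      exact _root_.partialSups_le _ _ _ fun i _ => hu ⟨i, rfl⟩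
    have h2 : ν uᶜ = 0 := by
      by_contra h0
      obtain ⟨n, hn⟩ := ENNReal.exists_inv_nat_lt h0
      have h3 : ν uᶜ ≤ ((n : ℝ≥0∞) + 1)⁻¹ :=
        (hν.mono _ _ (compl_le_compl (h1 n))).trans (hb1 n)
      have h4 : ((n : ℝ≥0∞) + 1)⁻¹ ≤ (n : ℝ≥0∞)⁻¹ := ENNReal.inv_le_inv.2 le_self_add
      exact absurd hn (h3.trans h4).not_gt
    rw [← compl_eq_bot.1 (hν.pos _ h2)]
  · rintro _ ⟨j, rfl⟩ n
    exact (hb2 j n).mono (disjointed_le b j)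

/-- Two positive continuous submeasures are absolutely continuous with respect to each other. -/
lemma IsMaharam.exists_forall_lt (hB : IsSigmaComplete B) {μ ν : B → ℝ≥0∞} (hμ : IsMaharam μ)
    (hν : IsMaharam ν) {ε : ℝ≥0∞} (hε : 0 < ε) : ∃ δ > 0, ∀ a, μ a < δ → ν a < ε := by
  by_contra! hc
  obtain ⟨δ, hδ, hsum⟩ := ENNReal.exists_pos_sum_of_countable' one_ne_zero ℕ
  choose a ha1 ha2 using fun n => hc (δ n) (hδ n)
  -- Borel–Cantelli: the suprema of the tails are `μ`-small, so they decrease to `⊥`, while `ν`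
  -- stays at least `ε` on them.
  obtain ⟨b, hb, hlub⟩ := hB.exists_tails a
  have htail : Tendsto (fun n => ∑' i, δ (i + n)) atTop (𝓝 0) :=
    ENNReal.tendsto_sum_nat_add δ (hsum.trans ENNReal.one_lt_top).ne
  have hμb : ∀ n, μ (b n) ≤ ∑' i, δ (i + n) := fun n =>
    (hμ.le_tsum (hlub n)).trans (ENNReal.tsum_le_tsum fun i => by
      rw [add_comm i n]
      exact (ha1 _).le)
  have hglb : IsGLB (Set.range b) ⊥ := by
    refine ⟨fun _ _ => bot_le, fun c hc => le_of_eq (hμ.pos c ?_)⟩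
    refine le_antisymm (ge_of_tendsto' htail fun n => ?_) zero_le
    exact (hμ.mono _ _ (hc ⟨n, rfl⟩)).trans (hμb n)
  obtain ⟨n, hn⟩ := ((hν.tendsto b hb hglb).eventually (gt_mem_nhds hε)).exists
  exact absurd hn ((ha2 n).trans (hν.mono _ _ ((hlub n).1 ⟨0, rfl⟩))).not_gt

lemma IsFinAddMeasure.sum_eq {μ : B → ℝ≥0} (hμ : IsFinAddMeasure μ) {ι : Type*} [DecidableEq ι]
    (s : Finset ι) (f : ι → B) (hf : ∀ i j, i ≠ j → f i ⊓ f j = ⊥) :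
    ∑ i ∈ s, μ (f i) = μ (s.sup f) := by
  induction s using Finset.induction_on with
  | empty => simp [hμ.map_bot]
  | insert a s ha ih =>
    rw [Finset.sum_insert ha, ih, Finset.sup_insert, hμ.sup_eq]
    refine disjoint_iff.1 (Finset.disjoint_sup_right.2 fun i hi => disjoint_iff.2 (hf a i ?_))
    rintro rfl
    exact ha hi

lemma isMaharam_coe {μ : B → ℝ≥0} (h1 : IsFinAddMeasure μ) (h2 : IsContinuous μ)
    (h3 : IsPositive μ) : IsMaharam fun b => (μ b : ℝ≥0∞) where
  map_bot := by simp [h1.map_bot]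
  mono a b hab := by exact_mod_cast h1.mono a b hab
  sup_le a b := by exact_mod_cast h1.sup_le a b
  pos a ha := h3 a (by exact_mod_cast ha)
  tendsto A hA hglb := by
    rw [← ENNReal.coe_zero, ENNReal.tendsto_coe]
    exact h2 A hA hglb

/-- A positive continuous submeasure on a measure algebra is uniformly exhaustive. -/
theorem IsMaharam.not_isMeasureAlgebra {ν : B → ℝ≥0∞} (hν : IsMaharam ν)
    (s : ∀ n : ℕ, Fin (n + 1) → B) (hdisj : ∀ n i j, i ≠ j → s n i ⊓ s n j = ⊥)
    (hs : ∀ n i, 1 ≤ ν (s n i)) : ¬ IsMeasureAlgebra B := by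
  rintro ⟨hB, μ, h1, h2, h3⟩
  obtain ⟨δ, hδ, hμν⟩ := (isMaharam_coe h1 h2 h3).exists_forall_lt hB hν one_pos
  obtain ⟨r, hr0, hrδ⟩ := ENNReal.lt_iff_exists_nnreal_btwn.1 hδ
  have hr : 0 < r := by exact_mod_cast hr0
  obtain ⟨n, hn⟩ := exists_nat_gt (μ ⊤ / r)
  have hle : ∀ i, r ≤ μ (s n i) := by
    intro i
    by_contra! hlt
    refine absurd (hμν (s n i) (lt_trans ?_ hrδ)) (hs n i).not_gt
    exact_mod_cast hlt
  have hsum : ((n + 1 : ℕ) : ℝ≥0) * r ≤ μ ⊤ := by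
    calc ((n + 1 : ℕ) : ℝ≥0) * r = ∑ _i : Fin (n + 1), r := by simp
      _ ≤ ∑ i, μ (s n i) := Finset.sum_le_sum fun i _ => hle i
      _ = μ (Finset.univ.sup (s n)) := h1.sum_eq _ _ (hdisj n)
      _ ≤ μ ⊤ := h1.mono _ _ le_top
  rw [div_lt_iff₀ hr] at hn
  refine absurd (lt_of_lt_of_le hn (le_trans ?_ hsum)) (lt_irrefl _)
  gcongr
  exact_mod_cast Nat.le_succ n

end BooleanAlgebra

/-! ### The quotient of a Boolean algebra by an ideal -/

section Quotient

variable {A : Type*} [BooleanAlgebra A]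

lemma sdiff_mem_trans {I : Order.Ideal A} {a b c : A} (hab : a \ b ∈ I) (hbc : b \ c ∈ I) :
    a \ c ∈ I := I.lower (sdiff_triangle a b c) (I.sup_mem hab hbc)

lemma sdiff_self_mem (I : Order.Ideal A) (a : A) : a \ a ∈ I := by
  rw [sdiff_self]; exact I.bot_mem

/-- Equality up to a member of an ideal. -/
@[reducible] def idealSetoid (I : Order.Ideal A) : Setoid A where
  r a b := a \ b ∈ I ∧ b \ a ∈ I
  iseqv :=
    ⟨fun a => ⟨sdiff_self_mem I a, sdiff_self_mem I a⟩, fun h => ⟨h.2, h.1⟩,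
      fun h h' => ⟨sdiff_mem_trans h.1 h'.1,
        sdiff_mem_trans h'.2 h.2⟩⟩

/-- The quotient of a Boolean algebra by an ideal. -/
def IdealQuotient (I : Order.Ideal A) : Type _ := Quotient (idealSetoid I)

namespace IdealQuotient

variable (I : Order.Ideal A)

/-- The class of an element. -/
def mk (a : A) : IdealQuotient I := Quotient.mk (idealSetoid I) a

variable {I}

lemma mk_surjective : Function.Surjective (mk I) := Quotient.mk_surjective

lemma sup_sdiff_mem {a b c d : A} (h : a \ b ∈ I) (h' : c \ d ∈ I) : (a ⊔ c) \ (b ⊔ d) ∈ I := by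
  refine I.lower ?_ (I.sup_mem h h')
  rw [sup_sdiff]
  exact sup_le_sup (sdiff_le_sdiff_left le_sup_left) (sdiff_le_sdiff_left le_sup_right)

lemma inf_sdiff_mem {a b c d : A} (h : a \ b ∈ I) (h' : c \ d ∈ I) : (a ⊓ c) \ (b ⊓ d) ∈ I := by
  refine I.lower ?_ (I.sup_mem h h')
  rw [sdiff_inf]
  exact sup_le_sup (sdiff_le_sdiff_right inf_le_left) (sdiff_le_sdiff_right inf_le_right)

lemma compl_sdiff_mem {a b : A} (h : b \ a ∈ I) : aᶜ \ bᶜ ∈ I := by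
  rwa [compl_sdiff_compl]

lemma sdiff_mem_of_le {a b : A} (h : a ≤ b) : a \ b ∈ I := by
  rw [sdiff_eq_bot_iff.2 h]; exact I.bot_mem

instance : PartialOrder (IdealQuotient I) where
  le := Quotient.lift₂ (s₁ := idealSetoid I) (s₂ := idealSetoid I) (fun a b => a \ b ∈ I)
    fun _ _ _ _ h h' => propext
      ⟨fun h1 => sdiff_mem_trans h.2 (sdiff_mem_trans h1 h'.1),
        fun h1 => sdiff_mem_trans h.1 (sdiff_mem_trans h1 h'.2)⟩
  le_refl := by
    rintro ⟨a⟩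
    exact sdiff_self_mem I a
  le_trans := by
    rintro ⟨a⟩ ⟨b⟩ ⟨c⟩ h h'
    exact sdiff_mem_trans h h'
  le_antisymm := by
    rintro ⟨a⟩ ⟨b⟩ h h'
    exact Quotient.sound (s := idealSetoid I) ⟨h, h'⟩

instance : BooleanAlgebra (IdealQuotient I) where
  sup := Quotient.map₂ (· ⊔ ·) fun _ _ h _ _ h' =>
    ⟨sup_sdiff_mem h.1 h'.1, sup_sdiff_mem h.2 h'.2⟩
  le_sup_left := by
    rintro ⟨a⟩ ⟨b⟩
    exact sdiff_mem_of_le le_sup_left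
  le_sup_right := by
    rintro ⟨a⟩ ⟨b⟩
    exact sdiff_mem_of_le le_sup_right
  sup_le := by
    rintro ⟨a⟩ ⟨b⟩ ⟨c⟩ h h'
    have := sup_sdiff_mem h h'
    rwa [sup_idem] at this
  inf := Quotient.map₂ (· ⊓ ·) fun _ _ h _ _ h' =>
    ⟨inf_sdiff_mem h.1 h'.1, inf_sdiff_mem h.2 h'.2⟩
  inf_le_left := by
    rintro ⟨a⟩ ⟨b⟩
    exact sdiff_mem_of_le inf_le_left
  inf_le_right := by
    rintro ⟨a⟩ ⟨b⟩
    exact sdiff_mem_of_le inf_le_right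
  le_inf := by
    rintro ⟨a⟩ ⟨b⟩ ⟨c⟩ h h'
    have := inf_sdiff_mem h h'
    rwa [inf_idem] at this
  le_sup_inf := by
    rintro ⟨a⟩ ⟨b⟩ ⟨c⟩
    exact sdiff_mem_of_le le_sup_inf
  compl := Quotient.map compl fun _ _ h => ⟨compl_sdiff_mem h.2, compl_sdiff_mem h.1⟩
  top := mk I ⊤
  bot := mk I ⊥
  inf_compl_le_bot := by
    rintro ⟨a⟩
    exact sdiff_mem_of_le (inf_compl_self a).le
  top_le_sup_compl := by
    rintro ⟨a⟩
    exact sdiff_mem_of_le (sup_compl_eq_top (x := a)).ge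
  le_top := by
    rintro ⟨a⟩
    exact sdiff_mem_of_le le_top
  bot_le := by
    rintro ⟨a⟩
    exact sdiff_mem_of_le bot_le

lemma mk_inf (a b : A) : mk I (a ⊓ b) = mk I a ⊓ mk I b := rfl

lemma mk_bot : mk I ⊥ = ⊥ := rfl

end IdealQuotient

end Quotient

/-! ### The quotient of a σ-algebra by the null sets of an exhaustive outer measure -/

section NullQuotient

variable {Ω : Type*} [MeasurableSpace Ω]

/-- The ideal of the measurable null sets of an outer measure. -/
noncomputable def nullIdeal (μ : OuterMeasure Ω) : Order.Ideal {s : Set Ω // MeasurableSet s} where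
  carrier := {s | μ s = 0}
  lower' _ _ hst hs := measure_mono_null hst hs
  nonempty' := ⟨⊥, measure_empty⟩
  directed' s hs t ht := ⟨s ⊔ t, measure_union_null hs ht, (le_sup_left : s ≤ s ⊔ t),
    (le_sup_right : t ≤ s ⊔ t)⟩

variable {μ : OuterMeasure Ω}

open IdealQuotient

lemma mk_le_mk_iff {s t : {s : Set Ω // MeasurableSet s}} :
    mk (nullIdeal μ) s ≤ mk (nullIdeal μ) t ↔ μ ((s : Set Ω) \ t) = 0 := Iff.rfl

lemma measure_le_of_mk_le {s t : {s : Set Ω // MeasurableSet s}}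
    (h : mk (nullIdeal μ) s ≤ mk (nullIdeal μ) t) : μ s ≤ μ t := by
  calc μ (s : Set Ω) ≤ μ ((t : Set Ω) ∪ (s : Set Ω) \ t) :=
        measure_mono (by rw [Set.union_sdiff_self]; exact Set.subset_union_right)
    _ ≤ μ (t : Set Ω) + μ ((s : Set Ω) \ t) := measure_union_le _ _
    _ = μ t := by rw [mk_le_mk_iff.1 h, add_zero]

/-- The function induced by an outer measure on the quotient by its null sets. -/
noncomputable def quotientMeasure (μ : OuterMeasure Ω) : IdealQuotient (nullIdeal μ) → ℝ≥0∞ :=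
  Quotient.lift (s := idealSetoid (nullIdeal μ)) (fun s => μ s) fun _ _ h =>
    le_antisymm (measure_le_of_mk_le h.1) (measure_le_of_mk_le h.2)

lemma isLUB_mk_iUnion (g : ℕ → {s : Set Ω // MeasurableSet s}) :
    IsLUB (Set.range fun i => mk (nullIdeal μ) (g i))
      (mk (nullIdeal μ) ⟨⋃ i, (g i : Set Ω), MeasurableSet.iUnion fun i => (g i).2⟩) := by
  refine ⟨?_, fun u hu => ?_⟩
  · rintro _ ⟨i, rfl⟩
    exact sdiff_mem_of_le (Set.subset_iUnion (fun i => (g i : Set Ω)) i)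
  · obtain ⟨s, rfl⟩ := mk_surjective u
    rw [mk_le_mk_iff, Set.iUnion_sdiff]
    exact measure_iUnion_null fun i => mk_le_mk_iff.1 (hu ⟨i, rfl⟩)

lemma isSigmaComplete_quotient (μ : OuterMeasure Ω) :
    IsSigmaComplete (IdealQuotient (nullIdeal μ)) := by
  intro C hC
  rcases C.eq_empty_or_nonempty with rfl | hne
  · exact ⟨⊥, isLUB_empty⟩
  · obtain ⟨f, rfl⟩ := hC.exists_eq_range hne
    choose g hg using fun i => mk_surjective (f i)
    obtain rfl : (fun i => mk (nullIdeal μ) (g i)) = f := funext hg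
    exact ⟨_, isLUB_mk_iUnion g⟩

lemma isMaharam_quotientMeasure (h : ExhaustiveOn μ {s | MeasurableSet s}) :
    IsMaharam (quotientMeasure μ) where
  map_bot := measure_empty (μ := μ)
  mono := by
    intro a b hab
    obtain ⟨s, rfl⟩ := mk_surjective a
    obtain ⟨t, rfl⟩ := mk_surjective b
    exact measure_le_of_mk_le hab
  sup_le := by
    intro a b
    obtain ⟨s, rfl⟩ := mk_surjective a
    obtain ⟨t, rfl⟩ := mk_surjective b
    exact measure_union_le (μ := μ) (s : Set Ω) t
  pos := by
    intro a ha
    obtain ⟨s, rfl⟩ := mk_surjective a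
    refine le_bot_iff.1 (mk_le_mk_iff.2 ?_)
    exact measure_mono_null Set.sdiff_subset ha
  tendsto := by
    intro A hA hglb
    choose g hg using fun i => mk_surjective (A i)
    obtain rfl : (fun i => mk (nullIdeal μ) (g i)) = A := funext hg
    have halg : IsSetAlgebra {s : Set Ω | MeasurableSet s} :=
      ⟨MeasurableSet.empty, fun _ hs => MeasurableSet.compl hs,
        fun _ _ hs ht => MeasurableSet.union hs ht⟩
    -- The class of the intersection lies below every `A i`, hence is `⊥`.
    have hinter : μ (⋂ i, (g i : Set Ω)) = 0 := by
      let t : {s : Set Ω // MeasurableSet s} := ⟨⋂ i, (g i : Set Ω), .iInter fun i => (g i).2⟩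
      have hle : mk (nullIdeal μ) t ≤ ⊥ := hglb.2 (by
        rintro _ ⟨i, rfl⟩
        exact sdiff_mem_of_le (Set.iInter_subset (fun i => (g i : Set Ω)) i))
      have h1 := measure_le_of_mk_le (t := ⊥) hle
      exact le_antisymm (h1.trans (measure_empty (μ := μ)).le) zero_le
    let E : ℕ → Set Ω := Set.accumulate fun i => (g i : Set Ω)ᶜ
    have hE : ∀ n, MeasurableSet (E n) := fun n =>
      MeasurableSet.biUnion (Set.to_countable _) fun i _ => (g i).2.compl
    rw [ENNReal.tendsto_atTop_zero]
    intro ε hε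
    obtain ⟨N, hN⟩ := h.exists_iUnion_diff_le halg hE Set.monotone_accumulate hε
    refine ⟨N, fun n hn => le_trans (measure_le_of_mk_le (hA hn)) ?_⟩
    -- The representatives decrease only up to null sets, so the complements are accumulated and the
    -- null differences split off.
    have hsub : (g N : Set Ω) ⊆ ((⋃ i, E i) \ E N) ∪
        ((⋃ i : Set.Iic N, (g N : Set Ω) \ g i) ∪ ⋂ i, (g i : Set Ω)) := by
      intro x hx
      by_cases h1 : x ∈ ⋂ i, (g i : Set Ω)
      · exact Or.inr (Or.inr h1)
      by_cases h2 : x ∈ E N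
      · obtain ⟨i, hi, hxi⟩ := Set.mem_iUnion₂.1 h2
        exact Or.inr (Or.inl (Set.mem_iUnion.2 ⟨⟨i, hi⟩, hx, hxi⟩))
      · refine Or.inl ⟨?_, h2⟩
        rw [Set.mem_iInter, not_forall] at h1
        obtain ⟨i, hi⟩ := h1
        exact Set.mem_iUnion.2 ⟨i, Set.mem_iUnion₂.2 ⟨i, le_rfl, hi⟩⟩
    have hnull : μ ((⋃ i : Set.Iic N, (g N : Set Ω) \ g i) ∪ ⋂ i, (g i : Set Ω)) = 0 :=
      measure_union_null (measure_iUnion_null fun i => mk_le_mk_iff.1 (hA i.2)) hinter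
    calc μ (g N : Set Ω) ≤ _ := measure_mono hsub
      _ ≤ _ := measure_union_le _ _
      _ ≤ ε := by rw [hnull, add_zero]; exact hN

end NullQuotient

end VonNeumann

theorem theorem1p3 :
    ∃ (B : Type) (_ : BooleanAlgebra B),
      VonNeumann.IsSigmaComplete B ∧
      VonNeumann.CountableChainCondition B ∧
      VonNeumann.WeakSigmaInftyDistributive B ∧
      ¬ VonNeumann.IsMeasureAlgebra B := by
  open VonNeumann in
  -- Measurable here means approximable by cylinders, so exhaustivity passes to all measurable sets.
  let _ : MeasurableSpace Seq := approximableSpace exhaustiveOn_seqOuter isSetAlgebra_cylinders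
  have hex : ExhaustiveOn seqOuter {s | MeasurableSet s} :=
    exhaustiveOn_seqOuter.approximable isSetAlgebra_cylinders
  have hB := isSigmaComplete_quotient seqOuter
  have hν := isMaharam_quotientMeasure hex
  let s : ∀ n : ℕ, Fin (n + 1) → {s : Set Seq // MeasurableSet s} := fun n τ =>
    ⟨{z | z n = τ}, subset_approximable (coordinate_mem_cylinders n τ)⟩
  refine ⟨IdealQuotient (nullIdeal seqOuter), inferInstance, hB, hν.countableChainCondition hB,
    hν.weakSigmaInftyDistributive hB, hν.not_isMeasureAlgebra
      (fun n τ => IdealQuotient.mk _ (s n τ)) (fun n i j hij => ?_) one_le_seqOuter⟩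
  have : s n i ⊓ s n j = ⊥ := Subtype.ext (Set.eq_empty_of_forall_notMem
    fun z ⟨(h1 : z n = i), (h2 : z n = j)⟩ => hij (h1.symm.trans h2))
  rw [← IdealQuotient.mk_inf, this, IdealQuotient.mk_bot]
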